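/- Conventions. An inverse category is a category $\mathcal I$ admitting a function $\deg\colon \mathrm{ob}\,\mathcal I\to\mathbb N$ with $\deg i>\deg j$ for every non-identity map $i\to j$. For $i\in\mathcal I$ let $\partial(i/\mathcal I)$ be the full subcategory of $i/\mathcal I$ on the non-identity maps. For a diagram $X\in\mathbf C^{\mathcal I}$ the matching object is $M_iX=\lim(\partial(i/\mathcal I)\to\mathcal I\xrightarrow{X}\mathbf C)$, with matching map $m_iX\colon X_i\to M_iX$ induced by the maps $X_f$. Given a class of fibrations in $\mathbf C$, a map $p\colon E\to B$ in $\mathbf C^{\mathcal I}$ is a Reedy fibration if each relative matching map $E_i\to B_i\times_{M_iB}M_iE$ is a fibration. The pushforward of $k\colon C\to B$ along $p\colon B\to A$ is an object $p_*C\to A$ over $A$ with a universal map $\mathrm{ev}\colon p^*p_*C\to C$ over $B$: for every $T\to A$, each map $u\colon p^*T\to C$ over $B$ is $\mathrm{ev}\circ p^*(u^\dagger)$ for a unique $u^\dagger\colon T\to p_*C$ over $A$. Standing assumptions. Let $\mathcal I$ be an inverse category each of whose underslices $i/\mathcal I$ is finite (for instance a finite inverse category), and let $\mathbf C$ be a category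 with finite limits. Each of $\mathcal I$ and $\mathbf C$ is equipped with a wide subcategory of weak equivalences that contains the isomorphisms and satisfies 2-out-of-3. A diagram $\mathcal I\to\mathbf C$ is homotopical if it preserves weak equivalences. $\mathbf C$ is also equipped with a pullback-stable wide subcategory of fibrations such that pushforwards of fibrations along fibrations exist and are fibrations. Assume moreover: (1) weak equivalences in $\mathbf C$ are preserved by pullback along fibrations; (2) for every $f\colon A'\to A$ in $\mathbf C$, the functor $f^*$ takes weak equivalences over $A$ between fibrations over $A$ to weak equivalences; (3) for every fibration $p\colon B\to A$, $p_*$ takes weak equivalences over $B$ between fibrations over $B$ to weak equivalences; (4) for every commutative square $p g=f p'$ with $p\colon B\to A$, $p'\colon B'\to A'$ fibrations and $g\colon B'\to B$, $f\colon A'\to A$ weak equivalences, and every fibration $C\to B$, the map $(g^*\mathrm{ev})^\dagger\colon f^*p_*C\to p'_*g^*C$ is a weak equivalence. Lemma. Let $i\in\mathcal I$ be such that every map out of $i$ is a weak equivalence. Let $p\colon B\to A$ be a Reedy fibration between homotopical diagrams in $\mathbf C^{\mathcal I}$, and let $k\colon C\to B$ be a Reedy fibration with $C$ homotopical. Then the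 pushforward $p_*C\to A$ of $k$ along $p$ in $\mathbf C^{\mathcal I}$ exists and is a Reedy fibration, and it sends every map out of $i$ to a weak equivalence of $\mathbf C$. Moreover, for every $j$ admitting a map $i\to j$ (in particular $j=i$), the pushforward $(p_j)_*C_j$ exists in $\mathbf C$, and the comparison map $\kappa_j\colon (p_*C)_j\to (p_j)_*C_j$, the exponential transpose of the component $\mathrm{ev}_j\colon p_j^*(p_*C)_j\to C_j$ of the evaluation map, is a weak equivalence. -/

import Mathlib

open CategoryTheory CategoryTheory.Limits

universe v₁ u₁ v₂ u₂

namespace InverseDiagrams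

section Boundary

variable {I : Type u₁} [Category.{v₁} I]

/-- `I` is an inverse category: some grading of its objects by natural numbers is strictly
decreased by every map `f : i ⟶ j` that is not an identity. -/
class IsInverse (I : Type u₁) [Category.{v₁} I] : Prop where
  exists_deg : ∃ deg : I → ℕ, ∀ ⦃i j : I⦄ (f : i ⟶ j), Under.mk f ≠ Under.mk (𝟙 i) → deg j < deg i

/-- The boundary `∂(i/I)`: the full subcategory of the underslice `i/I` on the non-identity
maps out of `i`. -/
abbrev Boundary (i : I) : Type (max u₁ v₁) :=
  ObjectProperty.FullSubcategory (fun f : Under i => f ≠ Under.mk (𝟙 i))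

/-- The projection `∂(i/I) ⥤ I` sending `f : i ⟶ j` to `j`. -/
def boundaryForget (i : I) : Boundary i ⥤ I :=
  ObjectProperty.ι _ ⋙ Under.forget i

/-- An object of `∂(i/I)`, seen as a map out of `i`. -/
def boundaryHom {i : I} (f : Boundary i) : i ⟶ (boundaryForget i).obj f :=
  f.obj.hom

theorem boundaryHom_comp {i : I} {f g : Boundary i} (φ : f ⟶ g) :
    boundaryHom f ≫ (boundaryForget i).map φ = boundaryHom g :=
  Under.w φ.hom

theorem finite_boundary_hom [∀ i : I, Finite (Under i)] (i : I) (f g : Boundary i) :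
    Finite (f ⟶ g) := by
  refine Finite.of_injective
    (fun φ : f ⟶ g => (Under.mk ((boundaryForget i).map φ) : Under ((boundaryForget i).obj f))) ?_
  intro φ ψ h
  have h' : (boundaryForget i).map φ = (boundaryForget i).map ψ :=
    eq_of_heq (Comma.mk.inj h).2.2
  exact InducedCategory.hom_ext (Under.UnderMorphism.ext h')

instance hasLimitsOfShape_boundary {C : Type u₂} [Category.{v₂} C] [HasFiniteLimits C]
    [∀ i : I, Finite (Under i)] (i : I) : HasLimitsOfShape (Boundary i) C := by
  have := finite_boundary_hom i
  have : Finite (Boundary i) := Finite.of_injective (fun f => f.obj)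
    (fun f g h => by cases f; cases g; cases h; rfl)
  let e : Boundary i ≌ AsSmall.{max u₁ v₁} (Boundary i) := AsSmall.equiv
  have hobj : Finite (AsSmall.{max u₁ v₁} (Boundary i)) :=
    inferInstanceAs (Finite (ULift (Boundary i)))
  have hhom : ∀ f g : AsSmall.{max u₁ v₁} (Boundary i), Finite (f ⟶ g) := fun f g =>
    Finite.of_injective (fun φ => e.inverse.map φ) e.inverse.map_injective
  have : FinCategory (AsSmall.{max u₁ v₁} (Boundary i)) :=
    { fintypeObj := Fintype.ofFinite _
      fintypeHom := fun f g => Fintype.ofFinite _ }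
  exact hasLimitsOfShape_of_equivalence e.symm

end Boundary

section Reedy

variable {I : Type u₁} [Category.{v₁} I] {C : Type u₂} [Category.{v₂} C] [HasFiniteLimits C]
  [∀ i : I, Finite (Under i)]

/-- The matching object `M_i X`, the limit of `∂(i/I) ⥤ I ⥤ C`. -/
noncomputable def matchingObj (X : I ⥤ C) (i : I) : C :=
  limit (boundaryForget i ⋙ X)

/-- The cone on `∂(i/I) ⥤ I ⥤ C` with point `X_i` given by the maps `X_f`. -/
def matchingCone (X : I ⥤ C) (i : I) : Cone (boundaryForget i ⋙ X) where
  pt := X.obj i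
  π :=
    { app := fun f => X.map (boundaryHom f)
      naturality := fun f g φ => by
        simp [← X.map_comp, boundaryHom_comp] }

/-- The matching map `m_i X : X_i ⟶ M_i X`, induced by the maps `X_f`. -/
noncomputable def matchingMap (X : I ⥤ C) (i : I) : X.obj i ⟶ matchingObj X i :=
  limit.lift (boundaryForget i ⋙ X) (matchingCone X i)

/-- The functorial action `M_i φ : M_i X ⟶ M_i Y` of the matching object. -/
noncomputable def matchingObjMap {X Y : I ⥤ C} (φ : X ⟶ Y) (i : I) :
    matchingObj X i ⟶ matchingObj Y i :=
  limMap (Functor.whiskerLeft (boundaryForget i) φ)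

theorem matchingMap_naturality {X Y : I ⥤ C} (φ : X ⟶ Y) (i : I) :
    φ.app i ≫ matchingMap Y i = matchingMap X i ≫ matchingObjMap φ i := by
  apply limit.hom_ext
  intro f
  simp [matchingMap, matchingObjMap, matchingCone, matchingObj]

/-- The relative matching map `E_i ⟶ B_i ×_{M_i B} M_i E` of a map of diagrams `φ : E ⟶ B`. -/
noncomputable def relMatchingMap {E B : I ⥤ C} (φ : E ⟶ B) (i : I) :
    E.obj i ⟶ pullback (matchingMap B i) (matchingObjMap φ i) :=
  pullback.lift (φ.app i) (matchingMap E i) (matchingMap_naturality φ i)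

/-- A map of diagrams is a Reedy fibration when all its relative matching maps are fibrations. -/
def IsReedyFibration (Fib : MorphismProperty C) {E B : I ⥤ C} (φ : E ⟶ B) : Prop :=
  ∀ i : I, Fib (relMatchingMap φ i)

end Reedy

/-- A diagram is homotopical when it preserves weak equivalences. -/
def IsHomotopical {I : Type u₁} [Category.{v₁} I] {C : Type u₂} [Category.{v₂} C]
    (WI : MorphismProperty I) (W : MorphismProperty C) (X : I ⥤ C) : Prop :=
  ∀ ⦃i j : I⦄ (f : i ⟶ j), WI f → W (X.map f)

section Pushforward

variable {C : Type u₂} [Category.{v₂} C]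

/-- A pushforward of `k : X ⟶ B`, seen as an object over `B`, along `p : B ⟶ A`: an object
`hom : obj ⟶ A` over `A`, together with a pullback `pb = p^* obj` and a map `ev : p^* obj ⟶ X`
over `B` which is universal. That is, for each `t : T ⟶ A` with pullback `Y = p^* T`, every map
`u : Y ⟶ X` over `B` is `ev ∘ p^* v` for a unique `v : T ⟶ obj` over `A`. (Below, `w` is `p^* v`;
the conditions force `w` to be the map induced by `v` between the pullbacks.) -/
structure Pushforward {X B A : C} (k : X ⟶ B) (p : B ⟶ A) where
  /-- the domain of the pushforward `p_* X ⟶ A` -/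
  obj : C
  /-- the structure map `p_* X ⟶ A` -/
  hom : obj ⟶ A
  /-- the pullback `p^* p_* X` -/
  pb : C
  /-- the projection `p^* p_* X ⟶ p_* X` -/
  proj : pb ⟶ obj
  /-- the evaluation `p^* p_* X ⟶ X`, a map over `B` -/
  ev : pb ⟶ X
  isPullback : IsPullback proj (ev ≫ k) hom p
  existsUnique_transpose : ∀ {T Y : C} (t : T ⟶ A) (y : Y ⟶ T) (u : Y ⟶ X),
    IsPullback y (u ≫ k) t p →
      ∃! v : T ⟶ obj, v ≫ hom = t ∧ ∃ w : Y ⟶ pb, w ≫ proj = y ≫ v ∧ w ≫ ev = u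

namespace Pushforward

/-- The exponential transpose `u^† : T ⟶ p_* X` over `A` of a map `u : p^* T ⟶ X` over `B`. -/
noncomputable def transpose {X B A : C} {k : X ⟶ B} {p : B ⟶ A} (P : Pushforward k p)
    {T Y : C} (t : T ⟶ A) (y : Y ⟶ T) (u : Y ⟶ X) (h : IsPullback y (u ≫ k) t p) : T ⟶ P.obj :=
  (P.existsUnique_transpose t y u h).choose

/-- The action `p_* w : p_* X ⟶ p_* X'` of pushforward on a map `w : X ⟶ X'` over `B`. -/
noncomputable def map {X X' B A : C} {k : X ⟶ B} {k' : X' ⟶ B} {p : B ⟶ A}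
    (P : Pushforward k p) (P' : Pushforward k' p) (w : X ⟶ X') (hw : w ≫ k' = k) :
    P.obj ⟶ P'.obj :=
  P'.transpose P.hom P.proj (P.ev ≫ w) (by rw [Category.assoc, hw]; exact P.isPullback)

/-- The evaluation map `g^* ev : p'^* f^* p_* X ≅ g^* p^* p_* X ⟶ g^* X` over `B'`, for a
commutative square `g ≫ p = p' ≫ f`. Here `F = f^* p_* X`, `D = g^* X` and
`G = p'^* f^* p_* X` are arbitrary pullbacks. -/
noncomputable def pullbackEv {X B A B' A' : C} {k : X ⟶ B} {p : B ⟶ A} (P : Pushforward k p)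
    {p' : B' ⟶ A'} {g : B' ⟶ B} {f : A' ⟶ A} (sq : g ≫ p = p' ≫ f)
    {F : C} {a : F ⟶ P.obj} {a' : F ⟶ A'} (hF : IsPullback a a' P.hom f)
    {D : C} {d : D ⟶ X} {k' : D ⟶ B'} (hD : IsPullback d k' k g)
    {G : C} {b : G ⟶ F} {b' : G ⟶ B'} (hG : IsPullback b b' a' p') : G ⟶ D :=
  hD.lift
    (P.isPullback.lift (b ≫ a) (b' ≫ g)
      (by rw [Category.assoc, hF.w, ← Category.assoc, hG.w, Category.assoc, Category.assoc, sq])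
      ≫ P.ev)
    b' (by rw [Category.assoc, P.isPullback.lift_snd])

/-- The comparison map `(g^* ev)^† : f^* p_* X ⟶ p'_* g^* X` over `A'` for a commutative square
`g ≫ p = p' ≫ f`, where `F = f^* p_* X` and `D = g^* X`. -/
noncomputable def precomp [HasPullbacks C] {X B A B' A' : C} {k : X ⟶ B} {p : B ⟶ A}
    (P : Pushforward k p) {p' : B' ⟶ A'} {g : B' ⟶ B} {f : A' ⟶ A} (sq : g ≫ p = p' ≫ f)
    {F : C} {a : F ⟶ P.obj} {a' : F ⟶ A'} (hF : IsPullback a a' P.hom f)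
    {D : C} {d : D ⟶ X} {k' : D ⟶ B'} (hD : IsPullback d k' k g)
    (P' : Pushforward k' p') : F ⟶ P'.obj :=
  P'.transpose a' (pullback.fst a' p')
    (P.pullbackEv sq hF hD (IsPullback.of_hasPullback a' p'))
    (by
      rw [pullbackEv, IsPullback.lift_snd]
      exact IsPullback.of_hasPullback a' p')

/-- The comparison map `κ_j : (p_* X)_j ⟶ (p_j)_* X_j` for a pushforward of diagrams: the
exponential transpose of the component at `j` of the evaluation `ev : p^* p_* X ⟶ X`. -/
noncomputable def comparison {I : Type u₁} [Category.{v₁} I] [HasPullbacks C]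
    {X B A : I ⥤ C} {k : X ⟶ B} {p : B ⟶ A} (P : Pushforward k p) (j : I)
    (Pj : Pushforward (k.app j) (p.app j)) : P.obj.obj j ⟶ Pj.obj :=
  Pj.transpose (P.hom.app j) (P.proj.app j) (P.ev.app j)
    (P.isPullback.map ((evaluation I C).obj j))

end Pushforward

end Pushforward

section Assumptions

variable {C : Type u₂} [Category.{v₂} C]

/-- Pushforwards of fibrations along fibrations exist, and are fibrations. -/
structure FibrationsStableUnderPushforward (Fib : MorphismProperty C) : Prop where
  nonempty_pushforward : ∀ {X B A : C} (k : X ⟶ B) (p : B ⟶ A), Fib k → Fib p →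
    Nonempty (Pushforward k p)
  fib_hom : ∀ {X B A : C} {k : X ⟶ B} {p : B ⟶ A} (P : Pushforward k p), Fib k → Fib p →
    Fib P.hom

/-- Pullbacks are homotopically logically behaved. -/
structure PullbacksLogicallyBehaved (Fib W : MorphismProperty C) : Prop where
  /-- Weak equivalences are preserved by pullback along fibrations. -/
  weq_of_isPullback : ∀ {X' X Y' Y : C} {w' : X' ⟶ X} {q' : X' ⟶ Y'} {q : X ⟶ Y} {w : Y' ⟶ Y},
    IsPullback w' q' q w → Fib q → W w → W w'
  /-- Pullbacks preserve weak equivalences between fibrations: for fibrations `x : X ⟶ A` and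
  `y : Y ⟶ A`, a weak equivalence `w : X ⟶ Y` over `A`, and any `f : A' ⟶ A`, the map
  `f^* w : f^* X ⟶ f^* Y` is a weak equivalence. -/
  weq_pullback : ∀ {A' A X Y X' Y' : C} {f : A' ⟶ A} {x : X ⟶ A} {y : Y ⟶ A}
    {x₁ : X' ⟶ X} {x₂ : X' ⟶ A'} {y₁ : Y' ⟶ Y} {y₂ : Y' ⟶ A'}
    (hX : IsPullback x₁ x₂ x f) (hY : IsPullback y₁ y₂ y f) (w : X ⟶ Y) (hw : w ≫ y = x),
    Fib x → Fib y → W w →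
      W (hY.lift (x₁ ≫ w) x₂ (by rw [Category.assoc, hw, hX.w]))

/-- Pushforwards are homotopically logically behaved. -/
structure PushforwardsLogicallyBehaved [HasPullbacks C] (Fib W : MorphismProperty C) : Prop where
  /-- Pushforwards along fibrations preserve weak equivalences between fibrations. -/
  weq_map : ∀ {X X' B A : C} {k : X ⟶ B} {k' : X' ⟶ B} {p : B ⟶ A}
    (P : Pushforward k p) (P' : Pushforward k' p) (w : X ⟶ X') (hw : w ≫ k' = k),
    Fib p → Fib k → Fib k' → W w → W (P.map P' w hw)
  /-- For a commutative square with `p`, `p'` fibrations and `f`, `g` weak equivalences, and a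
  fibration `k : X ⟶ B`, the map `(g^* ev)^† : f^* p_* X ⟶ p'_* g^* X` is a weak equivalence. -/
  weq_precomp : ∀ {X B A B' A' : C} {k : X ⟶ B} {p : B ⟶ A} (P : Pushforward k p)
    {p' : B' ⟶ A'} {g : B' ⟶ B} {f : A' ⟶ A} (sq : g ≫ p = p' ≫ f)
    {F : C} {a : F ⟶ P.obj} {a' : F ⟶ A'} (hF : IsPullback a a' P.hom f)
    {D : C} {d : D ⟶ X} {k' : D ⟶ B'} (hD : IsPullback d k' k g)
    (P' : Pushforward k' p'),
    Fib k → Fib p → Fib p' → W f → W g → W (P.precomp sq hF hD P')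

end Assumptions

end InverseDiagrams

/-!
Fix `i` and a cosieve `S` of maps out of `i`. The natural families of maps `T ×_{A_j} B_j ⟶ X_j`
over `B_j`, one for each `f : i ⟶ j` in `S`, form a presheaf in `T` over `A_i`. If all
non-identity composites of `f : i ⟶ j` lie in `S`, then adding `f` to `S` replaces this presheaf
by its pullback along postcomposition with the relative matching map `X_j ⟶ B_j ×_{M_j B} M_j X`
of `k`. The representing object is thereby replaced by a pullback of a pushforward of that
fibration. By induction on the finite cosieve `S`, all these presheaves are representable. For `S`
the set of all maps the representing object is `(p_* X)_i`, for `S` the set of non-identity maps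
it is `A_i ×_{M_i A} M_i (p_* X)`, and the map between them is a fibration.

Precomposing the families with `A_f` and `B_f` turns them into families of maps `T ×_{A_i} B_i ⟶
X_j`, which for the full cosieve are represented by `(p_i)_* X_i`. The map this induces on
representing objects is `κ_i`, and the same induction, with the gluing lemma for pullbacks of
fibrations and assumption (4), shows that it is a weak equivalence.
-/

namespace InverseDiagrams

open Opposite

universe w v u

section RepresentedMaps

variable {D : Type u} [Category.{v} D]

/-- For objects `R`, `R'` representing presheaves `F`, `G` with universal elements `x`, `y`,
the map `e : R ⟶ R'` is the one given by the Yoneda lemma from `φ : F ⟶ G`. -/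
def Represents {F G : Dᵒᵖ ⥤ Type w} (φ : F ⟶ G) {R R' : D} (x : F.obj (op R)) (y : G.obj (op R'))
    (e : R ⟶ R') : Prop :=
  G.map e.op y = φ.app (op R) x

variable {F G K M : Dᵒᵖ ⥤ Type w} {R R' R'' Q : D} {x : F.obj (op R)} {y : G.obj (op R')}
  {z : K.obj (op R'')} {z' : M.obj (op Q)}

theorem exists_represents (hG : G.IsRepresentedBy y) (φ : F ⟶ G) (x : F.obj (op R)) :
    ∃ e : R ⟶ R', Represents φ x y e :=
  hG.map_bijective.2 (φ.app (op R) x)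

namespace Represents

variable {φ : F ⟶ G} {χ : G ⟶ K} {e : R ⟶ R'} {d : R' ⟶ R''}

theorem map_comp (he : Represents φ x y e) {T : D} (v : T ⟶ R) :
    G.map (v ≫ e).op y = φ.app (op T) (F.map v.op x) := by
  rw [NatTrans.naturality_apply, ← he, op_comp, Functor.map_comp_apply]

theorem comp (he : Represents φ x y e) (hd : Represents χ y z d) :
    Represents (φ ≫ χ) x z (e ≫ d) :=
  (hd.map_comp e).trans (congrArg (χ.app (op R)) he)

theorem eq {e' : R ⟶ R'} (he : Represents φ x y e) (hG : G.IsRepresentedBy y)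
    (he' : Represents φ x y e') : e = e' :=
  hG.map_bijective.1 (he.trans he'.symm)

protected theorem id (x : F.obj (op R)) : Represents (𝟙 F) x x (𝟙 R) := by
  simp [Represents]

theorem isIso [IsIso φ] (he : Represents φ x y e) (hF : F.IsRepresentedBy x)
    (hG : G.IsRepresentedBy y) : IsIso e := by
  obtain ⟨d, hd⟩ := exists_represents hF (inv φ) y
  refine ⟨d, ?_, ?_⟩
  · have h := he.comp hd
    rw [IsIso.hom_inv_id] at h
    exact h.eq hF (.id x)
  · have h := hd.comp he
    rw [IsIso.inv_hom_id] at h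
    exact h.eq hG (.id y)

theorem isPullback {π : F ⟶ G} {ψ : F ⟶ K} {φ : G ⟶ M} {χ : K ⟶ M} (H : IsPullback π ψ φ χ)
    (hF : F.IsRepresentedBy x) (hG : G.IsRepresentedBy y) (hK : K.IsRepresentedBy z)
    (hM : M.IsRepresentedBy z') {eπ : R ⟶ R'} {eψ : R ⟶ R''} {eφ : R' ⟶ Q} {eχ : R'' ⟶ Q}
    (hπ : Represents π x y eπ) (hψ : Represents ψ x z eψ) (hφ : Represents φ y z' eφ)
    (hχ : Represents χ z z' eχ) : IsPullback eπ eψ eφ eχ := by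
  have exists_lift : ∀ {T : D} (a : T ⟶ R') (b : T ⟶ R''), a ≫ eφ = b ≫ eχ →
      ∃ v : T ⟶ R, v ≫ eπ = a ∧ v ≫ eψ = b := by
    intro T a b hab
    obtain ⟨s, hsa, hsb⟩ := Types.exists_of_isPullback (H.app (op T)) (G.map a.op y)
      (K.map b.op z) (by rw [← hφ.map_comp, ← hχ.map_comp, hab])
    obtain ⟨v, rfl⟩ := hF.map_bijective.2 s
    exact ⟨v, hG.map_bijective.1 ((hπ.map_comp v).trans hsa),
      hK.map_bijective.1 ((hψ.map_comp v).trans hsb)⟩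
  have hom_ext : ∀ {T : D} (v v' : T ⟶ R), v ≫ eπ = v' ≫ eπ → v ≫ eψ = v' ≫ eψ → v = v' :=
    fun {T} v v' hv hv' => hF.map_bijective.1 (Types.ext_of_isPullback (H.app (op T))
      (by rw [← hπ.map_comp, ← hπ.map_comp, hv]) (by rw [← hψ.map_comp, ← hψ.map_comp, hv']))
  choose lift hfst hsnd using @exists_lift
  exact ⟨⟨(hπ.comp hφ).eq hM (H.w ▸ hψ.comp hχ)⟩,
    ⟨PullbackCone.IsLimit.mk _ (fun s => lift s.fst s.snd s.condition) (fun _ => hfst _ _ _)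
      (fun _ => hsnd _ _ _) fun _ _ hv hv' => hom_ext _ _ (hv.trans (hfst _ _ _).symm)
      (hv'.trans (hsnd _ _ _).symm)⟩⟩

end Represents

/-- Every map that `φ : F ⟶ G` induces from an object representing `F` to one representing `G`
belongs to `Q`. -/
def RepresentedIn (Q : MorphismProperty D) (φ : F ⟶ G) : Prop :=
  ∀ ⦃R R' : D⦄ ⦃x : F.obj (op R)⦄ ⦃y : G.obj (op R')⦄ ⦃e : R ⟶ R'⦄,
    F.IsRepresentedBy x → G.IsRepresentedBy y → Represents φ x y e → Q e

theorem Represents.representedIn {Q : MorphismProperty D} [Q.RespectsIso] {φ : F ⟶ G} {e : R ⟶ R'}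
    (he : Represents φ x y e) (hF : F.IsRepresentedBy x) (hG : G.IsRepresentedBy y) (hQ : Q e) :
    RepresentedIn Q φ := by
  intro S S' x' y' d hF' hG' hd
  obtain ⟨t, ht⟩ := exists_represents hF (𝟙 F) x'
  obtain ⟨t', ht'⟩ := exists_represents hG (𝟙 G) y'
  have : IsIso t := ht.isIso hF' hF
  have : IsIso t' := ht'.isIso hG' hG
  have hw : t ≫ e = d ≫ t' := (ht.comp he).eq hG (by simpa using hd.comp ht')
  exact (Q.arrow_mk_iso_iff (Arrow.isoMk (asIso t) (asIso t') hw)).2 hQ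

end RepresentedMaps

instance {C : Type u} [Category.{v} C] (Q : MorphismProperty C) [Q.RespectsIso] {Z : C} :
    (Q.over (X := Z)).RespectsIso :=
  inferInstanceAs (Q.inverseImage (Over.forget Z)).RespectsIso

section PullbackHom

variable {C : Type u} [Category.{v} C] {A B X Y : C}

/-- A map `T ×_A Y ⟶ X` over `B`, encoded by its action on generalized elements of `T ×_A Y`, so
that no pullback has to be chosen and restriction in `T` is strictly functorial. The universe `w`
allows presheaves of such maps to be compared with presheaves of families of such maps. -/
@[ext]
structure PullbackHom (q : Y ⟶ A) (b : Y ⟶ B) (k : X ⟶ B) (T : Over A) :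
    Type (max w u v) where
  ev {V : C} (x : V ⟶ T.left) (y : V ⟶ Y) (h : x ≫ T.hom = y ≫ q) : V ⟶ X
  ev_comp {V : C} (x : V ⟶ T.left) (y : V ⟶ Y) (h : x ≫ T.hom = y ≫ q) : ev x y h ≫ k = y ≫ b
  comp_ev {V V' : C} (z : V' ⟶ V) (x : V ⟶ T.left) (y : V ⟶ Y) (h : x ≫ T.hom = y ≫ q) :
    z ≫ ev x y h = ev (z ≫ x) (z ≫ y) (by simp only [Category.assoc, h])

variable {q : Y ⟶ A} {b : Y ⟶ B} {k : X ⟶ B} {T : Over A}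

namespace PullbackHom

theorem ev_congr (u : PullbackHom.{w} q b k T) {V : C} {x x' : V ⟶ T.left} {y y' : V ⟶ Y}
    (hx : x = x') (hy : y = y') (h : x ≫ T.hom = y ≫ q) :
    u.ev x y h = u.ev x' y' (by rw [← hx, ← hy, h]) := by
  subst hx hy
  rfl

theorem ext_ev {u u' : PullbackHom.{w} q b k T}
    (H : ∀ {V : C} (x : V ⟶ T.left) (y : V ⟶ Y) (h : x ≫ T.hom = y ≫ q),
      u.ev x y h = u'.ev x y h) : u = u' := by
  ext V x y h
  exact H x y h

section IsPullback

variable {P : C} {fst : P ⟶ T.left} {snd : P ⟶ Y} (hP : IsPullback fst snd T.hom q)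

include hP

theorem ev_eq_lift_comp (u : PullbackHom.{w} q b k T) {V : C} (x : V ⟶ T.left) (y : V ⟶ Y)
    (h : x ≫ T.hom = y ≫ q) : u.ev x y h = hP.lift x y h ≫ u.ev fst snd hP.w := by
  rw [u.comp_ev]
  exact u.ev_congr (hP.lift_fst _ _ _).symm (hP.lift_snd _ _ _).symm h

theorem ext_of_isPullback {u u' : PullbackHom.{w} q b k T}
    (H : u.ev fst snd hP.w = u'.ev fst snd hP.w) : u = u' :=
  ext_ev fun x y h => by rw [u.ev_eq_lift_comp hP, H, ← u'.ev_eq_lift_comp hP]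

/-- The encoding of an actual map out of a pullback `P` of `T` and `Y`. -/
noncomputable def ofHom (m : P ⟶ X) (hm : m ≫ k = snd ≫ b) : PullbackHom.{w} q b k T where
  ev x y h := hP.lift x y h ≫ m
  ev_comp x y h := by rw [Category.assoc, hm, hP.lift_snd_assoc]
  comp_ev z x y h := by
    rw [← Category.assoc]
    congr 1
    apply hP.hom_ext <;> simp

theorem ofHom_ev_fst_snd (m : P ⟶ X) (hm : m ≫ k = snd ≫ b) :
    (ofHom.{w} hP m hm).ev fst snd hP.w = m := by
  have hid : hP.lift fst snd hP.w = 𝟙 P := by apply hP.hom_ext <;> simp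
  simp only [ofHom, hid, Category.id_comp]

end IsPullback

/-- Restriction along a map over `A`. -/
@[simps]
def restrict {T' : Over A} (v : T' ⟶ T) (u : PullbackHom.{w} q b k T) :
    PullbackHom.{w} q b k T' where
  ev x y h := u.ev (x ≫ v.left) y (by simp [h])
  ev_comp x y h := u.ev_comp _ _ _
  comp_ev z x y h := (u.comp_ev _ _ _ _).trans (u.ev_congr (Category.assoc _ _ _).symm rfl _)

/-- Postcomposition with a map `m : X ⟶ X'` over `β : B ⟶ B'`. -/
@[simps]
def postcomp {X' B' : C} {b' : Y ⟶ B'} {k' : X' ⟶ B'} (m : X ⟶ X') (β : B ⟶ B')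
    (hb : b ≫ β = b') (hm : m ≫ k' = k ≫ β) (u : PullbackHom.{w} q b k T) :
    PullbackHom.{w} q b' k' T where
  ev x y h := u.ev x y h ≫ m
  ev_comp x y h := by rw [Category.assoc, hm, reassoc_of% u.ev_comp, hb]
  comp_ev z x y h := by rw [← Category.assoc, u.comp_ev]

/-- Precomposition with the map `T ×_{A'} Y' ⟶ T ×_A Y` induced by a square `g ≫ q = q' ≫ f`, for
`T` over `Z` and compatible maps `a : Z ⟶ A` and `a' : Z ⟶ A'`. -/
@[simps]
def precomp {Y' A' Z : C} {q' : Y' ⟶ A'} {b' : Y' ⟶ B} {a : Z ⟶ A} {a' : Z ⟶ A'} (g : Y' ⟶ Y)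
    (f : A' ⟶ A) (sq : g ≫ q = q' ≫ f) (ha : a' ≫ f = a) (hb : g ≫ b = b') {T : Over Z}
    (u : PullbackHom.{w} q b k ((Over.map a).obj T)) :
    PullbackHom.{w} q' b' k ((Over.map a').obj T) where
  ev x y h := u.ev x (y ≫ g) (by
    have h' : x ≫ T.hom ≫ a' = y ≫ q' := h
    simp [← ha, sq, reassoc_of% h'])
  ev_comp x y h := by rw [u.ev_comp, Category.assoc, hb]
  comp_ev z x y h := (u.comp_ev _ _ _ _).trans (u.ev_congr rfl (Category.assoc _ _ _).symm _)

end PullbackHom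

/-- The presheaf of maps `T ×_A Y ⟶ X` over `B`, for `T` over `A`. -/
abbrev pullbackHomPsh (q : Y ⟶ A) (b : Y ⟶ B) (k : X ⟶ B) : (Over A)ᵒᵖ ⥤ Type (max w u v) where
  obj T := PullbackHom.{w} q b k T.unop
  map v := ↾fun u => u.restrict v.unop
  map_id T := by
    ext u V x y h
    exact u.ev_congr (Category.comp_id x) rfl _
  map_comp v v' := by
    ext u V x y h
    exact u.ev_congr (Category.assoc x _ _).symm rfl _

namespace pullbackHomPsh

/-- Postcomposition with a map `m : X ⟶ X'` over `β : B ⟶ B'`, as a map of presheaves. -/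
abbrev postcomp (q : Y ⟶ A) {X' B' : C} {b' : Y ⟶ B'} {k' : X' ⟶ B'} (m : X ⟶ X') (β : B ⟶ B')
    (hb : b ≫ β = b') (hm : m ≫ k' = k ≫ β) :
    pullbackHomPsh.{w} q b k ⟶ pullbackHomPsh.{w} q b' k' where
  app _ := ↾fun u => PullbackHom.postcomp m β hb hm u

/-- `PullbackHom.precomp` as a map of presheaves. -/
abbrev precomp {Y' A' Z : C} {q' : Y' ⟶ A'} {b' : Y' ⟶ B} {a : Z ⟶ A} {a' : Z ⟶ A'} (k : X ⟶ B)
    (g : Y' ⟶ Y) (f : A' ⟶ A) (sq : g ≫ q = q' ≫ f) (ha : a' ≫ f = a) (hb : g ≫ b = b') :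
    (Over.map a).op ⋙ pullbackHomPsh.{w} q b k ⟶
      (Over.map a').op ⋙ pullbackHomPsh.{w} q' b' k where
  app _ := ↾fun u => PullbackHom.precomp g f sq ha hb u

theorem postcomp_app_bijective {X' B' : C} {b' : Y ⟶ B'} {k' : X' ⟶ B'} {m : X ⟶ X'}
    {β : B ⟶ B'} (hb : b ≫ β = b') (hm : IsPullback m k k' β) (T : (Over A)ᵒᵖ) :
    Function.Bijective ((postcomp.{w} q m β hb hm.w).app T) := by
  refine ⟨fun u u' huu' => PullbackHom.ext_ev fun x y h => hm.hom_ext ?_ ?_, fun u => ?_⟩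
  · exact congrArg (fun s : PullbackHom.{w} q b' k' T.unop => s.ev x y h) huu'
  · rw [PullbackHom.ev_comp, PullbackHom.ev_comp]
  · have hu : ∀ {V : C} (x : V ⟶ T.unop.left) (y : V ⟶ Y) (h : x ≫ T.unop.hom = y ≫ q),
        PullbackHom.ev u x y h ≫ k' = (y ≫ b) ≫ β := fun x y h => by
      rw [PullbackHom.ev_comp, Category.assoc, hb]
    refine ⟨{ ev := fun x y h => hm.lift (PullbackHom.ev u x y h) (y ≫ b) (hu x y h)
              ev_comp := fun x y h => hm.lift_snd _ _ _
              comp_ev := fun z x y h => ?_ }, ?_⟩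
    · apply hm.hom_ext <;> simp [PullbackHom.comp_ev]
    · exact PullbackHom.ext_ev fun x y h => hm.lift_fst _ _ _

end pullbackHomPsh

end PullbackHom

theorem isRepresentedBy_map_of_isPullback {C : Type u} [Category.{v} C] {A Z : C}
    {F : (Over A)ᵒᵖ ⥤ Type w} {R : Over A} {x : F.obj (op R)} (hF : F.IsRepresentedBy x)
    {a : Z ⟶ A} {R' : Over Z} (f : (Over.map a).obj R' ⟶ R)
    (hf : IsPullback f.left R'.hom R.hom a) :
    ((Over.map a).op ⋙ F).IsRepresentedBy (X := R') (F.map f.op x) where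
  map_bijective {T} := by
    have hmap (v : T ⟶ R') :
        ((Over.map a).op ⋙ F).map v.op (F.map f.op x) = F.map ((Over.map a).map v ≫ f).op x := by
      simp
    refine ⟨fun v v' hvv' => ?_, fun s => ?_⟩
    · have h : (Over.map a).map v ≫ f = (Over.map a).map v' ≫ f :=
        hF.map_bijective.1 ((hmap v).symm.trans (hvv'.trans (hmap v')))
      ext
      exact hf.hom_ext (congrArg CommaMorphism.left h) (by simp)
    · obtain ⟨v, hv⟩ := hF.map_bijective.2 s
      let v' : T ⟶ R' := Over.homMk (hf.lift v.left T.hom (Over.w v)) (hf.lift_snd _ _ _)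
      have hv' : (Over.map a).map v' ≫ f = v := by
        ext
        exact hf.lift_fst _ _ _
      exact ⟨v', (hmap v').trans (by rw [hv']; exact hv)⟩

section PushforwardRepresents

variable {C : Type u} [Category.{v} C] {A B X Y Z : C}

namespace Pushforward

variable {k : X ⟶ B} {p : B ⟶ A} (P : Pushforward k p)

/-- The evaluation `p^* p_* X ⟶ X` as an element of the presheaf that `p_* X` represents. -/
noncomputable def evHom : PullbackHom.{w} p (𝟙 B) k (Over.mk P.hom) :=
  PullbackHom.ofHom P.isPullback P.ev (Category.comp_id _).symm

theorem evHom_ev_of_comp {V : C} (x : V ⟶ P.obj) (y : V ⟶ B) (h : x ≫ P.hom = y ≫ p)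
    (l : V ⟶ P.pb) (hx : l ≫ P.proj = x) (hy : l ≫ P.ev ≫ k = y) :
    (evHom.{w} P).ev x y h = l ≫ P.ev := by
  obtain rfl : l = P.isPullback.lift x y h := P.isPullback.hom_ext (by simpa) (by simpa)
  rfl

theorem isRepresentedBy_evHom [HasPullbacks C] :
    (pullbackHomPsh.{w} p (𝟙 B) k).IsRepresentedBy (X := Over.mk P.hom) P.evHom where
  map_bijective {T} := by
    have hT : IsPullback (pullback.fst T.hom p) (pullback.snd T.hom p) T.hom p :=
      .of_hasPullback _ _
    have hw (v : T ⟶ Over.mk P.hom) :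
        (pullback.fst T.hom p ≫ v.left) ≫ P.hom = pullback.snd T.hom p ≫ p := by
      have hv : v.left ≫ P.hom = T.hom := Over.w v
      rw [Category.assoc, hv, hT.w]
    refine ⟨fun v v' hvv' => ?_, fun s => ?_⟩
    · let u : pullback T.hom p ⟶ X := (evHom.{w} P).ev (pullback.fst T.hom p ≫ v.left)
        (pullback.snd T.hom p) (hw v)
      have hu : u ≫ k = pullback.snd T.hom p :=
        (PullbackHom.ev_comp _ _ _ _).trans (Category.comp_id _)
      have hu' : (evHom.{w} P).ev (pullback.fst T.hom p ≫ v'.left) (pullback.snd T.hom p) (hw v')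
          = u :=
        congrArg (fun s : PullbackHom.{w} p (𝟙 B) k T => s.ev _ _ hT.w) hvv'.symm
      ext
      exact (P.existsUnique_transpose T.hom (pullback.fst T.hom p) u (by rwa [hu])).unique
        ⟨Over.w v, P.isPullback.lift _ _ _, P.isPullback.lift_fst _ _ _, rfl⟩
        ⟨Over.w v', P.isPullback.lift _ _ _, P.isPullback.lift_fst _ _ _, hu'⟩
    · let u : pullback T.hom p ⟶ X := s.ev _ _ hT.w
      have hu : u ≫ k = pullback.snd T.hom p := (s.ev_comp _ _ _).trans (Category.comp_id _)
      obtain ⟨t, ⟨ht, l, hl, hlu⟩, -⟩ :=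
        P.existsUnique_transpose T.hom (pullback.fst T.hom p) u (by rwa [hu])
      have hlk : l ≫ P.ev ≫ k = pullback.snd T.hom p := by rw [← hu, ← hlu, Category.assoc]
      refine ⟨Over.homMk t ht, PullbackHom.ext_of_isPullback hT ?_⟩
      exact (evHom_ev_of_comp.{w} P _ _ _ l hl hlk).trans hlu

theorem isRepresentedBy_postcomp_evHom [HasPullbacks C] {q : Y ⟶ A} {b : Y ⟶ B} {k : X ⟶ B}
    {D : C} {d : D ⟶ X} {k' : D ⟶ Y} (P : Pushforward k' q) (hD : IsPullback d k' k b) :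
    (pullbackHomPsh.{w} q b k).IsRepresentedBy (X := Over.mk P.hom)
      (P.evHom.postcomp d b (Category.id_comp b) hD.w) := by
  let φ : pullbackHomPsh.{w} q (𝟙 Y) k' ⟶ pullbackHomPsh.{w} q b k :=
    pullbackHomPsh.postcomp q d b (Category.id_comp b) hD.w
  have : IsIso φ := by
    rw [NatTrans.isIso_iff_isIso_app]
    exact fun T => (isIso_iff_bijective _).2 (pullbackHomPsh.postcomp_app_bijective _ hD T)
  exact P.isRepresentedBy_evHom.of_natIso (asIso φ)

end Pushforward

end PushforwardRepresents

section FibrationExtension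

variable {C : Type u} [Category.{v} C] {A B X Y N : C} {q : Y ⟶ A} {b : Y ⟶ B} {k : X ⟶ B}
  {n : N ⟶ B}

namespace PullbackHom

variable {R T : Over A} (o : PullbackHom.{w} q b n R) (m : X ⟶ N) (hm : m ≫ n = k)
  {P : C} {fst : P ⟶ R.left} {snd : P ⟶ Y} (hP : IsPullback fst snd R.hom q) (e : T ⟶ R)

theorem comp_left_comp_hom {V : C} {x : V ⟶ T.left} {y : V ⟶ Y} (h : x ≫ T.hom = y ≫ q) :
    (x ≫ e.left) ≫ R.hom = y ≫ q := by
  rw [Category.assoc, Over.w, h]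

/-- A lift along `m : X ⟶ N` of the restriction along `e : T ⟶ R` of `o : R ×_A Y ⟶ N`, given as
a section over `T` of the pullback of `m` to `R ×_A Y`. -/
@[simps]
noncomputable def ofLift (u : PullbackHom.{w} fst (o.ev fst snd hP.w) m (Over.mk e.left)) :
    PullbackHom.{w} q b k T where
  ev x y h := u.ev x (hP.lift (x ≫ e.left) y (comp_left_comp_hom e h)) (hP.lift_fst _ _ _).symm
  ev_comp x y h := by
    rw [← hm, reassoc_of% u.ev_comp, ← Category.assoc, ← o.ev_eq_lift_comp hP, o.ev_comp]
  comp_ev z x y h := by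
    rw [u.comp_ev]
    refine u.ev_congr rfl ?_ _
    apply hP.hom_ext <;> simp

theorem ofLift_postcomp (u : PullbackHom.{w} fst (o.ev fst snd hP.w) m (Over.mk e.left)) :
    (o.ofLift m hm hP e u).postcomp m (𝟙 B) (Category.comp_id b) (by rw [hm, Category.comp_id]) =
      o.restrict e :=
  ext_ev fun _ _ _ => (u.ev_comp _ _ _).trans (o.ev_eq_lift_comp hP _ _ _).symm

theorem ofLift_injective : Function.Injective (o.ofLift m hm hP e) := fun u u' huu' =>
  ext_ev fun x y (h : x ≫ e.left = y ≫ fst) => by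
    have hx : x ≫ T.hom = (y ≫ snd) ≫ q := by
      rw [← Over.w e, reassoc_of% h, hP.w, Category.assoc]
    have hlift : hP.lift (x ≫ e.left) (y ≫ snd) (comp_left_comp_hom e hx) = y := by
      apply hP.hom_ext <;> simp [h]
    have := congrArg (fun s => s.ev x (y ≫ snd) hx) huu'
    simpa only [ofLift_ev, hlift] using this

theorem exists_ofLift_eq (u : PullbackHom.{w} q b k T)
    (hu : u.postcomp m (𝟙 B) (Category.comp_id b) (by rw [hm, Category.comp_id]) =
      o.restrict e) :
    ∃ u', o.ofLift m hm hP e u' = u := by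
  have hx {V : C} (x : V ⟶ T.left) (y : V ⟶ P) (h : x ≫ e.left = y ≫ fst) :
      x ≫ T.hom = (y ≫ snd) ≫ q := by
    rw [← Over.w e, reassoc_of% h, hP.w, Category.assoc]
  refine ⟨{ ev := fun x y h => u.ev x (y ≫ snd) (hx x y h)
            ev_comp := fun x y h => ?_
            comp_ev := fun z x y h =>
              (u.comp_ev _ _ _ _).trans (u.ev_congr rfl (Category.assoc _ _ _).symm _) },
    ext_ev fun x y h => u.ev_congr rfl (hP.lift_snd _ _ _) _⟩
  rw [o.comp_ev]
  exact (congrArg (fun s => s.ev x (y ≫ snd) (hx x y h)) hu).trans (o.ev_congr h rfl _)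

theorem ofLift_restrict {T' : Over A} {v : T' ⟶ T} {d : T' ⟶ R} (hd : v ≫ e = d)
    (v' : Over.mk d.left ⟶ Over.mk e.left) (hv' : v'.left = v.left)
    (u : PullbackHom.{w} fst (o.ev fst snd hP.w) m (Over.mk e.left)) :
    o.ofLift m hm hP d (u.restrict v') = (o.ofLift m hm hP e u).restrict v := by
  subst hd
  exact ext_ev fun x y h => u.ev_congr (by rw [hv']) (by simp) _

end PullbackHom

section Presheaf

variable {Z : C} {a : Z ⟶ A} {m : X ⟶ N} (hm : m ≫ n = k) {F G : (Over Z)ᵒᵖ ⥤ Type (max w u v)}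
  {π : F ⟶ G} {ψ : F ⟶ (Over.map a).op ⋙ pullbackHomPsh.{w} q b k}
  {φ : G ⟶ (Over.map a).op ⋙ pullbackHomPsh.{w} q b n}
  (H : IsPullback π ψ φ (Functor.whiskerLeft (Over.map a).op
    (pullbackHomPsh.postcomp q m (𝟙 B) (Category.comp_id b) (by rw [hm, Category.comp_id]))))
  {R : Over Z} {x : G.obj (op R)} (hG : G.IsRepresentedBy x)

include H hG

theorem isRepresentedBy_of_isPullback {P : C} {fst : P ⟶ R.left} {snd : P ⟶ Y}
    (hP : IsPullback fst snd ((Over.map a).obj R).hom q) {o : PullbackHom.{w} q b n _}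
    (ho : φ.app (op R) x = o) {E : Over Z} {e : E ⟶ R}
    {u : PullbackHom.{w} fst (o.ev fst snd hP.w) m (Over.mk e.left)}
    (hu : (pullbackHomPsh.{w} fst (o.ev fst snd hP.w) m).IsRepresentedBy u) {y : F.obj (op E)}
    (hπy : Represents π y x e) (hψy : ψ.app (op E) y = o.ofLift m hm hP ((Over.map a).map e) u) :
    F.IsRepresentedBy y where
  map_bijective {T} := by
    have hψ (v : T ⟶ E) {d : T ⟶ R} (hd : v ≫ e = d)
        (v' : Over.mk d.left ⟶ Over.mk e.left) (hv' : v'.left = v.left) :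
        ψ.app (op T) (F.map v.op y) = o.ofLift m hm hP ((Over.map a).map d) (u.restrict v') := by
      rw [NatTrans.naturality_apply, hψy]
      exact (o.ofLift_restrict m hm hP ((Over.map a).map e) (v := (Over.map a).map v)
        (d := (Over.map a).map d) (by rw [← hd, Functor.map_comp]) v' hv' u).symm
    refine ⟨fun v v' hvv' => ?_, fun s => ?_⟩
    · have hd : v' ≫ e = v ≫ e := hG.map_bijective.1 <|
        (hπy.map_comp v').trans <| (congrArg (π.app (op T)) hvv'.symm).trans (hπy.map_comp v).symm
      let t : Over.mk (v ≫ e).left ⟶ Over.mk e.left := Over.homMk v.left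
      let t' : Over.mk (v ≫ e).left ⟶ Over.mk e.left :=
        Over.homMk v'.left (congrArg CommaMorphism.left hd)
      have htt' : t = t' := hu.map_bijective.1 <| o.ofLift_injective m hm hP _ <|
        (hψ v rfl t rfl).symm.trans ((congrArg (ψ.app (op T)) hvv').trans (hψ v' hd t' rfl))
      ext
      exact congrArg (fun r => r.left) htt'
    · obtain ⟨d, hd⟩ := hG.map_bijective.2 (π.app (op T) s)
      obtain ⟨u', hu'⟩ := o.exists_ofLift_eq m hm hP ((Over.map a).map d) (ψ.app (op T) s) <| by
        have hs := congrArg (fun r => r.app (op T) s) H.w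
        refine hs.symm.trans ((congrArg (φ.app (op T)) hd.symm).trans ?_)
        exact (NatTrans.naturality_apply φ d.op x).trans (by rw [ho])
      obtain ⟨t, rfl⟩ := hu.map_bijective.2 u'
      have htw : t.left ≫ e.left = d.left := Over.w t
      let v : T ⟶ E := Over.homMk t.left (by rw [← Over.w e, reassoc_of% htw, Over.w])
      have hv : v ≫ e = d := by
        ext
        exact htw
      exact ⟨v, Types.ext_of_isPullback (H.app (op T)) (by rw [← hπy.map_comp, hv]; exact hd)
        ((hψ v hv t rfl).trans hu')⟩

theorem exists_isRepresentedBy_of_isPullback [HasPullbacks C] {Fib : MorphismProperty C}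
    [Fib.IsStableUnderBaseChange] (hFib : FibrationsStableUnderPushforward Fib) (hfm : Fib m)
    (hfq : Fib q) :
    ∃ (E : Over Z) (y : F.obj (op E)) (e : E ⟶ R),
      F.IsRepresentedBy y ∧ Represents π y x e ∧ Fib e.left := by
  let o : PullbackHom.{w} q b n ((Over.map a).obj R) := φ.app (op R) x
  have hP : IsPullback (pullback.fst ((Over.map a).obj R).hom q) (pullback.snd _ _) _ _ :=
    .of_hasPullback _ _
  let o' := o.ev _ _ hP.w
  have hm' : IsPullback (pullback.snd o' m) (pullback.fst o' m) m o' :=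
    (IsPullback.of_hasPullback o' m).flip
  have hfm' : Fib (pullback.fst o' m) := Fib.of_isPullback hm' hfm
  have hfst : Fib (pullback.fst ((Over.map a).obj R).hom q) := Fib.of_isPullback hP.flip hfq
  obtain ⟨P⟩ := hFib.nonempty_pushforward _ _ hfm' hfst
  let E : Over Z := Over.mk (P.hom ≫ R.hom)
  let e : E ⟶ R := Over.homMk P.hom
  let u : PullbackHom.{w} _ o' m (Over.mk e.left) :=
    P.evHom.postcomp (pullback.snd o' m) o' (Category.id_comp o') hm'.w
  obtain ⟨y, hπy, hψy⟩ := Types.exists_of_isPullback (H.app (op E)) (G.map e.op x)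
    (o.ofLift m hm hP ((Over.map a).map e) u)
    ((NatTrans.naturality_apply φ e.op x).trans (o.ofLift_postcomp m hm hP _ u).symm)
  exact ⟨E, y, e, isRepresentedBy_of_isPullback (o := o) (u := u) hm H hG hP rfl
    (P.isRepresentedBy_postcomp_evHom hm') hπy.symm hψy, hπy.symm, hFib.fib_hom P hfm' hfst⟩

end Presheaf

end FibrationExtension

section Cosieves

variable {I : Type u₁} [Category.{v₁} I]

theorem eq_of_underMk_right_eq_id {i : I} {f g : Under i} (u : f ⟶ g)
    (hu : Under.mk u.right = Under.mk (𝟙 f.right)) : f = g := by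
  obtain ⟨⟨⟨⟩⟩, j, f⟩ := f
  obtain ⟨⟨⟨⟩⟩, j', g⟩ := g
  have hw : f ≫ u.right = g := Under.w u
  obtain rfl : j' = j := congrArg (fun h : Under j => h.right) hu
  have hid : u.right = 𝟙 j' := eq_of_heq (Comma.mk.inj hu).2.2
  obtain rfl : f = g := (Category.comp_id f).symm.trans (hid ▸ hw)
  rfl

theorem exists_deg_right_lt_of_ne (I : Type u₁) [Category.{v₁} I] [IsInverse I] :
    ∃ deg : I → ℕ, ∀ {i : I} {f g : Under i}, (f ⟶ g) → f ≠ g → deg g.right < deg f.right := by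
  obtain ⟨deg, hdeg⟩ := IsInverse.exists_deg (I := I)
  exact ⟨deg, fun u hne => hdeg u.right fun hu => hne (eq_of_underMk_right_eq_id u hu)⟩

/-- A set of maps out of `i` closed under postcomposition. -/
def IsCosieve {i : I} (S : Set (Under i)) : Prop :=
  ∀ ⦃f g : Under i⦄, (f ⟶ g) → f ∈ S → g ∈ S

/-- The composite of `f` with a non-identity map out of its codomain. -/
abbrev extend {i : I} (f : Under i) (h : Boundary f.right) : Under i :=
  Under.mk (f.hom ≫ h.obj.hom)

/-- The map from `f` to its composite with a non-identity map. -/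
abbrev toExtend {i : I} (f : Under i) (h : Boundary f.right) : f ⟶ extend f h :=
  Under.homMk h.obj.hom

/-- The action of `extend f` on maps of `∂(j/I)`, for `f : i ⟶ j`. -/
abbrev extendMap {i : I} (f : Under i) {h h' : Boundary f.right} (φ : h ⟶ h') :
    extend f h ⟶ extend f h' :=
  Under.homMk φ.hom.right (by simp)

theorem toExtend_comp_extendMap {i : I} (f : Under i) {h h' : Boundary f.right} (φ : h ⟶ h') :
    toExtend f h ≫ extendMap f φ = toExtend f h' := by
  ext
  exact Under.w φ.hom

theorem under_hom_cases {i : I} {f : Under i} {P : ∀ g : Under i, (f ⟶ g) → Prop}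
    (id : P f (𝟙 f)) (toExtend : ∀ h : Boundary f.right, P (extend f h) (toExtend f h))
    {g : Under i} (u : f ⟶ g) : P g u := by
  by_cases hu : Under.mk u.right = Under.mk (𝟙 f.right)
  · obtain rfl := eq_of_underMk_right_eq_id u hu
    obtain rfl : u = 𝟙 f := by
      ext
      exact eq_of_heq (Comma.mk.inj hu).2.2
    exact id
  · have hP {j : I} (g : i ⟶ j) (r : f.right ⟶ j) (hr : f.hom ≫ r = g)
        (hne : Under.mk r ≠ Under.mk (𝟙 f.right)) : P (Under.mk g) (Under.homMk r hr) := by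
      subst hr
      exact toExtend ⟨Under.mk r, hne⟩
    exact hP g.hom u.right (Under.w u) hu

theorem extend_ne [IsInverse I] {i : I} (f : Under i) (h : Boundary f.right) :
    extend f h ≠ f := by
  obtain ⟨deg, hdeg⟩ := IsInverse.exists_deg (I := I)
  intro hf
  have hlt : deg (extend f h).right < deg f.right := hdeg h.obj.hom h.property
  rw [hf] at hlt
  exact lt_irrefl _ hlt

/-- An element of maximal degree can always be removed from a nonempty finite cosieve, and all
its non-identity composites remain. -/
theorem cosieve_induction [IsInverse I] {i : I} [Finite (Under i)] {P : Set (Under i) → Prop}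
    (empty : P ∅) (insert : ∀ (f : Under i) (S : Set (Under i)), f ∉ S → IsCosieve S →
      (∀ h : Boundary f.right, extend f h ∈ S) → P S → P (insert f S))
    {S : Set (Under i)} (hS : IsCosieve S) : P S := by
  obtain ⟨deg, hdeg⟩ := exists_deg_right_lt_of_ne I
  induction hn : S.ncard generalizing S with
  | zero =>
    rw [Set.ncard_eq_zero] at hn
    rwa [hn]
  | succ n ih =>
    have hne : S.Nonempty := by
      rw [← Set.ncard_pos, hn]
      omega
    obtain ⟨f, hf, hmax⟩ := Set.exists_max_image S (fun f => deg f.right) (Set.toFinite S) hne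
    have hSf : IsCosieve (S \ {f}) := by
      rintro g g' u ⟨hg, hgf⟩
      refine ⟨hS u hg, ?_⟩
      rintro rfl
      exact (hdeg u hgf).not_ge (hmax g hg)
    have hP := insert f (S \ {f}) (fun h => h.2 rfl) hSf
      (fun h => ⟨hS (toExtend f h) hf, extend_ne f h⟩)
      (ih hSf (by rw [Set.ncard_sdiff_singleton_of_mem hf, hn, Nat.add_sub_cancel]))
    rwa [Set.insert_sdiff_singleton, Set.insert_eq_of_mem hf] at hP

theorem isCosieve_univ (i : I) : IsCosieve (Set.univ : Set (Under i)) := fun _ _ _ _ => trivial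

theorem isCosieve_boundary [IsInverse I] (i : I) :
    IsCosieve {f : Under i | f ≠ Under.mk (𝟙 i)} := by
  obtain ⟨deg, hdeg⟩ := exists_deg_right_lt_of_ne I
  rintro f g u hf rfl
  exact lt_asymm (hdeg (Under.homMk f.hom) hf.symm) (hdeg u hf)

theorem underMk_comp_ne [IsInverse I] {i : I} (h : Boundary i) {l : I} (f : h.obj.right ⟶ l) :
    Under.mk (h.obj.hom ≫ f) ≠ Under.mk (𝟙 i) :=
  isCosieve_boundary i (Under.homMk f : h.obj ⟶ Under.mk (h.obj.hom ≫ f)) h.property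

end Cosieves

section RelMatchingObj

variable {I : Type u₁} [Category.{v₁} I] {C : Type u₂} [Category.{v₂} C] [HasFiniteLimits C]
  [∀ i : I, Finite (Under i)] {B X : I ⥤ C}

/-- The projection `M_j X ⟶ X_h` for a non-identity map `h` out of `j`. -/
noncomputable def matchingπ (X : I ⥤ C) {j : I} (h : Boundary j) :
    matchingObj X j ⟶ X.obj h.obj.right :=
  limit.π (boundaryForget j ⋙ X) h

theorem matchingMap_π (X : I ⥤ C) {j : I} (h : Boundary j) :
    matchingMap X j ≫ matchingπ X h = X.map h.obj.hom :=
  limit.lift_π _ _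

theorem matchingObjMap_π (k : X ⟶ B) {j : I} (h : Boundary j) :
    matchingObjMap k j ≫ matchingπ B h = matchingπ X h ≫ k.app h.obj.right :=
  limMap_π _ _

theorem exists_matchingObj_lift {j : I} {V : C} (u : ∀ h : Boundary j, V ⟶ X.obj h.obj.right)
    (hu : ∀ (h h' : Boundary j) (φ : h ⟶ h'), u h ≫ X.map φ.hom.right = u h') :
    ∃ v : V ⟶ matchingObj X j, ∀ h, v ≫ matchingπ X h = u h :=
  ⟨limit.lift (boundaryForget j ⋙ X)
    { pt := V
      π := { app := u
             naturality := fun _ _ φ => (Category.id_comp _).trans (hu _ _ φ).symm } },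
    fun _ => limit.lift_π _ _⟩

variable (k : X ⟶ B) (j : I)

/-- The object `B_j ×_{M_j B} M_j X`, the target of the relative matching map of `k` at `j`. -/
noncomputable abbrev relMatchingObj : C :=
  pullback (matchingMap B j) (matchingObjMap k j)

/-- The projection `B_j ×_{M_j B} M_j X ⟶ B_j`. -/
noncomputable abbrev relMatchingFst : relMatchingObj k j ⟶ B.obj j :=
  pullback.fst _ _

variable {j} in
/-- The projection `B_j ×_{M_j B} M_j X ⟶ X_h` for a non-identity map `h` out of `j`. -/
noncomputable def relMatchingπ (h : Boundary j) : relMatchingObj k j ⟶ X.obj h.obj.right :=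
  pullback.snd _ _ ≫ matchingπ X h

variable {k j}

theorem relMatchingObj_hom_ext {V : C} {u v : V ⟶ relMatchingObj k j}
    (hfst : u ≫ relMatchingFst k j = v ≫ relMatchingFst k j)
    (hπ : ∀ h : Boundary j, u ≫ relMatchingπ k h = v ≫ relMatchingπ k h) : u = v :=
  pullback.hom_ext hfst (limit.hom_ext fun h =>
    (Category.assoc _ _ _).trans ((hπ h).trans (Category.assoc _ _ _).symm))

theorem relMatchingMap_fst : relMatchingMap k j ≫ relMatchingFst k j = k.app j :=
  pullback.lift_fst _ _ _

theorem relMatchingMap_π (h : Boundary j) :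
    relMatchingMap k j ≫ relMatchingπ k h = X.map h.obj.hom := by
  rw [relMatchingMap, relMatchingπ, pullback.lift_snd_assoc, matchingMap_π]

theorem relMatchingπ_map {h h' : Boundary j} (φ : h ⟶ h') :
    relMatchingπ k h ≫ X.map φ.hom.right = relMatchingπ k h' :=
  (Category.assoc _ _ _).trans (congrArg (_ ≫ ·) (limit.w (boundaryForget j ⋙ X) φ))

theorem relMatchingπ_app (h : Boundary j) :
    relMatchingπ k h ≫ k.app _ = relMatchingFst k j ≫ B.map h.obj.hom := by
  rw [relMatchingπ, Category.assoc, ← matchingObjMap_π, ← pullback.condition_assoc, matchingMap_π]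

theorem exists_relMatchingObj_lift {V : C} (b : V ⟶ B.obj j)
    (u : ∀ h : Boundary j, V ⟶ X.obj h.obj.right)
    (hu : ∀ (h h' : Boundary j) (φ : h ⟶ h'), u h ≫ X.map φ.hom.right = u h')
    (hb : ∀ h : Boundary j, u h ≫ k.app _ = b ≫ B.map h.obj.hom) :
    ∃ v : V ⟶ relMatchingObj k j,
      v ≫ relMatchingFst k j = b ∧ ∀ h, v ≫ relMatchingπ k h = u h := by
  obtain ⟨v, hv⟩ := exists_matchingObj_lift u hu
  have hbv : b ≫ matchingMap B j = v ≫ matchingObjMap k j := limit.hom_ext fun h => by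
    change (b ≫ _) ≫ matchingπ B h = (v ≫ _) ≫ matchingπ B h
    rw [Category.assoc, Category.assoc, matchingMap_π, matchingObjMap_π, reassoc_of% hv, hb]
  exact ⟨pullback.lift b v hbv, pullback.lift_fst _ _ _, fun h => by
    rw [relMatchingπ, pullback.lift_snd_assoc, hv]⟩

end RelMatchingObj

section Sections

variable {I : Type u₁} [Category.{v₁} I] {C : Type u₂} [Category.{v₂} C] {B X : I ⥤ C} {i : I}
  {Z : C}

/-- A map `q : tot ⟶ base` of diagrams on `i/I`, with a map `b` from `tot` to the restriction of `B`
and a cone `a` on `base` with vertex `Z`. It indexes the families of maps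
`T ×_{base f} tot f ⟶ X_j` over `B_j`, for `T` over `Z` and `f : i ⟶ j`. -/
structure Shape (B : I ⥤ C) (i : I) (Z : C) where
  base : Under i ⥤ C
  tot : Under i ⥤ C
  a : ∀ f : Under i, Z ⟶ base.obj f
  a_map : ∀ {f g : Under i} (u : f ⟶ g), a f ≫ base.map u = a g
  q : ∀ f : Under i, tot.obj f ⟶ base.obj f
  q_map : ∀ {f g : Under i} (u : f ⟶ g), tot.map u ≫ q g = q f ≫ base.map u
  b : ∀ f : Under i, tot.obj f ⟶ B.obj f.right
  b_map : ∀ {f g : Under i} (u : f ⟶ g), tot.map u ≫ b g = b f ≫ B.map u.right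

theorem Shape.comp_hom_comp_a (D : Shape B i Z) {f g : Under i} (u : f ⟶ g) {T : Over Z} {V : C}
    {x : V ⟶ T.left} {y : V ⟶ D.tot.obj f} (h : x ≫ T.hom ≫ D.a f = y ≫ D.q f) :
    x ≫ T.hom ≫ D.a g = (y ≫ D.tot.map u) ≫ D.q g := by
  rw [← D.a_map u, Category.assoc, D.q_map, ← reassoc_of% h]

/-- Natural families of maps `T ×_{base f} tot f ⟶ X_j` over `B_j`, for `f : i ⟶ j` in `S`. -/
structure Sec (D : Shape B i Z) (k : X ⟶ B) (S : Set (Under i)) (T : Over Z) where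
  val : ∀ f ∈ S, PullbackHom.{max u₁ v₁} (D.q f) (D.b f) (k.app f.right)
    ((Over.map (D.a f)).obj T)
  natural : ∀ {f g : Under i} (hf : f ∈ S) (hg : g ∈ S) (u : f ⟶ g) {V : C} (x : V ⟶ T.left)
    (y : V ⟶ D.tot.obj f) (h : x ≫ T.hom ≫ D.a f = y ≫ D.q f),
    (val f hf).ev x y h ≫ X.map u.right =
      (val g hg).ev x (y ≫ D.tot.map u) (D.comp_hom_comp_a u h)

variable {D : Shape B i Z} {k : X ⟶ B} {S S' : Set (Under i)} {T : Over Z}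

namespace Sec

theorem ext_ev {s s' : Sec D k S T} (H : ∀ f (hf : f ∈ S) {V : C} (x : V ⟶ T.left)
    (y : V ⟶ D.tot.obj f) (h : x ≫ T.hom ≫ D.a f = y ≫ D.q f),
      (s.val f hf).ev x y h = (s'.val f hf).ev x y h) : s = s' := by
  obtain ⟨val, _⟩ := s
  obtain ⟨val', _⟩ := s'
  congr
  exact funext₂ fun f hf => PullbackHom.ext_ev (H f hf)

/-- Restriction along a map over `Z`. -/
@[simps]
def restrict {T' : Over Z} (v : T' ⟶ T) (s : Sec D k S T) : Sec D k S T' where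
  val f hf := (s.val f hf).restrict ((Over.map (D.a f)).map v)
  natural hf hg u _ x y h := s.natural hf hg u (x ≫ v.left) y (by simpa using h)

/-- Restriction to a smaller set of maps out of `i`. -/
@[simps]
def restrictSet (hS : S' ⊆ S) (s : Sec D k S T) : Sec D k S' T where
  val f hf := s.val f (hS hf)
  natural hf hg := s.natural (hS hf) (hS hg)

end Sec

/-- The presheaf of natural families of maps `T ×_{base f} tot f ⟶ X_j` over `B_j`, for
`f : i ⟶ j` in `S` and `T` over `Z`. -/
abbrev secPsh (D : Shape B i Z) (k : X ⟶ B) (S : Set (Under i)) :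
    (Over Z)ᵒᵖ ⥤ Type (max u₁ v₁ u₂ v₂) where
  obj T := Sec D k S T.unop
  map v := ↾fun s => s.restrict v.unop
  map_id T := by
    ext s
    exact Sec.ext_ev fun f hf V x y h => (Sec.val s f hf).ev_congr (Category.comp_id x) rfl _
  map_comp v v' := by
    ext s
    exact Sec.ext_ev fun f hf V x y h =>
      (Sec.val s f hf).ev_congr (Category.assoc x _ _).symm rfl _

namespace secPsh

/-- Evaluation of natural families at `f`. -/
abbrev eval (D : Shape B i Z) (k : X ⟶ B) {f : Under i} (hf : f ∈ S) :
    secPsh D k S ⟶ (Over.map (D.a f)).op ⋙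
      pullbackHomPsh.{max u₁ v₁} (D.q f) (D.b f) (k.app f.right) where
  app _ := ↾fun s => s.val f hf

/-- Restriction of natural families to a smaller set of maps out of `i`. -/
abbrev restrictSet (D : Shape B i Z) (k : X ⟶ B) (hS : S' ⊆ S) :
    secPsh D k S ⟶ secPsh D k S' where
  app _ := ↾fun s => s.restrictSet hS

theorem exists_isRepresentedBy_empty (D : Shape B i Z) (k : X ⟶ B) :
    ∃ s : Sec D k ∅ (Over.mk (𝟙 Z)), (secPsh D k ∅).IsRepresentedBy s := by
  refine ⟨⟨fun _ h => h.elim, fun h => h.elim⟩, ⟨fun {T} => ⟨fun v v' _ => ?_, fun s => ?_⟩⟩⟩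
  · exact Over.mkIdTerminal.hom_ext v v'
  · exact ⟨Over.mkIdTerminal.from T, Sec.ext_ev fun f hf => hf.elim⟩

end secPsh

namespace Sec

variable {f : Under i} (hf : ∀ h : Boundary f.right, extend f h ∈ S) (s : Sec D k S T)

section Extend

variable {V : C} (x : V ⟶ T.left) (y : V ⟶ D.tot.obj f) (hxy : x ≫ T.hom ≫ D.a f = y ≫ D.q f)

/-- The values of a natural family at the composites of `f` with non-identity maps, on a
generalized element of `T ×_{base f} tot f`. -/
def evExtend (h : Boundary f.right) : V ⟶ X.obj h.obj.right :=
  (s.val (extend f h) (hf h)).ev x (y ≫ D.tot.map (toExtend f h)) (D.comp_hom_comp_a _ hxy)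

theorem exists_lift_evExtend [HasFiniteLimits C] [∀ i : I, Finite (Under i)] :
    ∃ v : V ⟶ relMatchingObj k f.right, v ≫ relMatchingFst k f.right = y ≫ D.b f ∧
      ∀ h, v ≫ relMatchingπ k h = s.evExtend hf x y hxy h := by
  refine exists_relMatchingObj_lift _ _ (fun h h' φ => ?_) fun h => ?_
  · refine (s.natural (hf h) (hf h') (extendMap f φ) _ _ _).trans (PullbackHom.ev_congr _ rfl ?_ _)
    rw [Category.assoc, ← D.tot.map_comp, toExtend_comp_extendMap]
  · refine (PullbackHom.ev_comp _ _ _ _).trans ?_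
    rw [Category.assoc, D.b_map, Category.assoc]
    rfl

end Extend

variable [HasFiniteLimits C] [∀ i : I, Finite (Under i)]

/-- The map `T ×_{base f} tot f ⟶ B_j ×_{M_j B} M_j X`, for `f : i ⟶ j`, given by the values of a
natural family at the composites of `f` with non-identity maps. -/
noncomputable def matching : PullbackHom.{max u₁ v₁} (D.q f) (D.b f) (relMatchingFst k f.right)
    ((Over.map (D.a f)).obj T) where
  ev x y h := (s.exists_lift_evExtend hf x y h).choose
  ev_comp x y h := (s.exists_lift_evExtend hf x y h).choose_spec.1
  comp_ev z x y h := by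
    have hz : (z ≫ x) ≫ T.hom ≫ D.a f = (z ≫ y) ≫ D.q f := by
      rw [Category.assoc, Category.assoc]
      exact congrArg (z ≫ ·) h
    have hv := (s.exists_lift_evExtend hf x y h).choose_spec
    have hzv := (s.exists_lift_evExtend hf (z ≫ x) (z ≫ y) hz).choose_spec
    refine relMatchingObj_hom_ext ?_ fun g => ?_
    · exact (Category.assoc _ _ _).trans ((congrArg (z ≫ ·) hv.1).trans
        ((Category.assoc _ _ _).symm.trans hzv.1.symm))
    · refine (Category.assoc _ _ _).trans ((congrArg (z ≫ ·) (hv.2 g)).trans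
        (Eq.trans ?_ (hzv.2 g).symm))
      exact (PullbackHom.comp_ev _ _ _ _ _).trans
        (PullbackHom.ev_congr _ rfl (Category.assoc _ _ _).symm _)

theorem matching_ev_π {V : C} (x : V ⟶ T.left) (y : V ⟶ D.tot.obj f)
    (hxy : x ≫ T.hom ≫ D.a f = y ≫ D.q f) (h : Boundary f.right) :
    (s.matching hf).ev x y hxy ≫ relMatchingπ k h = s.evExtend hf x y hxy h :=
  (s.exists_lift_evExtend hf x y hxy).choose_spec.2 h

end Sec

end Sections

theorem exists_forall_mem_insert {α : Type u} {P : α → Type v} {S : Set α} {a : α} (ha : a ∉ S)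
    (x : P a) (y : ∀ b ∈ S, P b) :
    ∃ z : ∀ b ∈ insert a S, P b,
      z a (Set.mem_insert a S) = x ∧
        ∀ b (hb : b ∈ S), z b (Set.mem_insert_of_mem a hb) = y b hb := by
  classical
  refine ⟨fun b hb => if h : b = a then h ▸ x else y b (hb.resolve_left h), by simp, fun b hb => ?_⟩
  exact dif_neg (ne_of_mem_of_not_mem hb ha)

section Extension

variable {I : Type u₁} [Category.{v₁} I] {C : Type u₂} [Category.{v₂} C] {B X : I ⥤ C}

theorem Sec.exists_insert {i : I} {Z : C} {D : Shape B i Z} {k : X ⟶ B}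
    {S : Set (Under i)} {T : Over Z} {f : Under i} (hf : ∀ h : Boundary f.right, extend f h ∈ S)
    (hfS : f ∉ S) (hS : IsCosieve S) (s : Sec D k S T)
    (u : PullbackHom.{max u₁ v₁} (D.q f) (D.b f) (k.app f.right) ((Over.map (D.a f)).obj T))
    (hu : ∀ {V : C} (x : V ⟶ T.left) (y : V ⟶ D.tot.obj f)
      (hxy : x ≫ T.hom ≫ D.a f = y ≫ D.q f) (h : Boundary f.right),
      u.ev x y hxy ≫ X.map h.obj.hom = s.evExtend hf x y hxy h) :
    ∃ s' : Sec D k (insert f S) T,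
      s'.restrictSet (Set.subset_insert f S) = s ∧ s'.val f (Set.mem_insert f S) = u := by
  obtain ⟨val, hvalf, hvalS⟩ := exists_forall_mem_insert (P := fun g => PullbackHom.{max u₁ v₁}
    (D.q g) (D.b g) (k.app g.right) ((Over.map (D.a g)).obj T)) hfS u s.val
  have hvalext {h : Boundary f.right} : val (extend f h) _ = s.val (extend f h) (hf h) :=
    hvalS _ (hf h)
  refine ⟨⟨val, fun {g g'} hg hg' v V x y hxy => ?_⟩, ?_, hvalf⟩
  · obtain rfl | hgS := Set.mem_insert_iff.1 hg
    · induction v using under_hom_cases with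
      | id =>
        refine (congrArg _ (X.map_id _)).trans ((Category.comp_id _).trans ?_)
        exact PullbackHom.ev_congr _ rfl (by simp) _
      | toExtend h =>
        rw [hvalf, hvalext]
        exact hu x y hxy h
    · rw [hvalS g hgS, hvalS g' (hS v hgS)]
      exact s.natural hgS (hS v hgS) v x y hxy
  · exact ext_ev fun g hg V x y hxy =>
      congrArg (fun r : PullbackHom.{max u₁ v₁} (D.q g) (D.b g) (k.app g.right)
        ((Over.map (D.a g)).obj T) => r.ev x y hxy) (hvalS g hg)

variable [HasFiniteLimits C] [∀ i : I, Finite (Under i)]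

theorem PullbackHom.ext_relMatchingπ {k : X ⟶ B} {j : I} {A Y : C} {q : Y ⟶ A} {b : Y ⟶ B.obj j}
    {T : Over A} {u u' : PullbackHom.{w} q b (relMatchingFst k j) T}
    (H : ∀ {V : C} (x : V ⟶ T.left) (y : V ⟶ Y) (hxy : x ≫ T.hom = y ≫ q) (h : Boundary j),
      u.ev x y hxy ≫ relMatchingπ k h = u'.ev x y hxy ≫ relMatchingπ k h) : u = u' :=
  ext_ev fun x y hxy =>
    relMatchingObj_hom_ext ((u.ev_comp x y hxy).trans (u'.ev_comp x y hxy).symm) (H x y hxy)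

variable {i : I} {Z : C}

namespace Sec

variable {D : Shape B i Z} {k : X ⟶ B} {S : Set (Under i)} {T : Over Z} {f : Under i}
  (hf : ∀ h : Boundary f.right, extend f h ∈ S)

theorem postcomp_eq_matching_iff (s : Sec D k S T)
    (u : PullbackHom.{max u₁ v₁} (D.q f) (D.b f) (k.app f.right) ((Over.map (D.a f)).obj T)) :
    u.postcomp (relMatchingMap k f.right) (𝟙 _) (Category.comp_id _)
        (by rw [relMatchingMap_fst, Category.comp_id]) = s.matching hf ↔
      ∀ {V : C} (x : V ⟶ T.left) (y : V ⟶ D.tot.obj f) (hxy : x ≫ T.hom ≫ D.a f = y ≫ D.q f)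
        (h : Boundary f.right), u.ev x y hxy ≫ X.map h.obj.hom = s.evExtend hf x y hxy h := by
  refine ⟨fun hu V x y hxy h => ?_, fun H => PullbackHom.ext_relMatchingπ fun x y hxy h => ?_⟩
  · rw [← s.matching_ev_π hf, ← hu, PullbackHom.postcomp_ev, Category.assoc, relMatchingMap_π]
  · rw [PullbackHom.postcomp_ev, Category.assoc, relMatchingMap_π]
    exact (H x y hxy h).trans (s.matching_ev_π hf x y hxy h).symm

end Sec

variable (D : Shape B i Z) (k : X ⟶ B)

namespace secPsh

variable {S : Set (Under i)} {f : Under i}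

/-- The natural transformation with components `Sec.matching`. -/
noncomputable abbrev matching (hf : ∀ h : Boundary f.right, extend f h ∈ S) :
    secPsh D k S ⟶ (Over.map (D.a f)).op ⋙
      pullbackHomPsh.{max u₁ v₁} (D.q f) (D.b f) (relMatchingFst k f.right) where
  app _ := ↾fun s => s.matching hf
  naturality T T' v := by
    ext s
    refine PullbackHom.ext_relMatchingπ fun x y hxy h => ?_
    exact (Sec.matching_ev_π hf (Sec.restrict v.unop s) x y hxy h).trans
      (Sec.matching_ev_π hf s (x ≫ v.unop.left) y _ h).symm

/-- Postcomposition with the relative matching map of `k` at `f.right`. -/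
noncomputable abbrev postcompRelMatchingMap (f : Under i) :
    (Over.map (D.a f)).op ⋙ pullbackHomPsh.{max u₁ v₁} (D.q f) (D.b f) (k.app f.right) ⟶
      (Over.map (D.a f)).op ⋙
        pullbackHomPsh.{max u₁ v₁} (D.q f) (D.b f) (relMatchingFst k f.right) :=
  Functor.whiskerLeft (Over.map (D.a f)).op (pullbackHomPsh.postcomp (D.q f)
    (relMatchingMap k f.right) (𝟙 _) (Category.comp_id _)
    (by rw [relMatchingMap_fst, Category.comp_id]))

theorem isPullback_insert (hfS : f ∉ S) (hS : IsCosieve S)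
    (hf : ∀ h : Boundary f.right, extend f h ∈ S) :
    IsPullback (restrictSet D k (Set.subset_insert f S)) (eval D k (Set.mem_insert f S))
      (matching D k hf) (postcompRelMatchingMap D k f) := by
  refine .of_forall_isPullback_app fun T => (Types.isPullback_iff _ _ _ _).2 ⟨?_, ?_, ?_⟩
  · ext s
    refine ((Sec.postcomp_eq_matching_iff hf _ _).2 fun x y hxy h => ?_).symm
    exact Sec.natural s _ _ (toExtend f h) x y hxy
  · rintro s s' ⟨hS, hfs⟩
    refine Sec.ext_ev fun g hg V x y hxy => ?_
    rcases hg with rfl | hg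
    · exact congrArg (fun u : PullbackHom.{max u₁ v₁} (D.q g) (D.b g) (k.app g.right)
        ((Over.map (D.a g)).obj T.unop) => u.ev x y hxy) hfs
    · exact congrArg (fun r => (Sec.val r g hg).ev x y hxy) hS
  · intro s u hsu
    exact Sec.exists_insert hf hfS hS s u
      ((Sec.postcomp_eq_matching_iff hf s u).1 hsu.symm)

variable {Fib : MorphismProperty C} [Fib.IsStableUnderBaseChange]
  (hFib : FibrationsStableUnderPushforward Fib)

include hFib

theorem exists_isRepresentedBy_insert (hk : Fib (relMatchingMap k f.right)) (hq : Fib (D.q f))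
    (hfS : f ∉ S) (hS : IsCosieve S) (hf : ∀ h : Boundary f.right, extend f h ∈ S) {R : Over Z}
    {r : Sec D k S R} (hr : (secPsh D k S).IsRepresentedBy r) :
    ∃ (E : Over Z) (s : Sec D k (insert f S) E) (e : E ⟶ R),
      (secPsh D k (insert f S)).IsRepresentedBy s ∧
        Represents (restrictSet D k (Set.subset_insert f S)) s r e ∧ Fib e.left :=
  exists_isRepresentedBy_of_isPullback relMatchingMap_fst (isPullback_insert D k hfS hS hf) hr
    hFib hk hq

theorem exists_isRepresentedBy [IsInverse I] [Fib.IsMultiplicative] (hk : IsReedyFibration Fib k)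
    (hq : ∀ f, Fib (D.q f)) (hS : IsCosieve S) :
    ∃ (E : Over Z) (s : Sec D k S E), (secPsh D k S).IsRepresentedBy s ∧ Fib E.hom := by
  refine cosieve_induction (P := fun S => ∃ (E : Over Z) (s : Sec D k S E),
    (secPsh D k S).IsRepresentedBy s ∧ Fib E.hom) ?_ (fun f S hfS hS hf => ?_) hS
  · obtain ⟨s, hs⟩ := exists_isRepresentedBy_empty D k
    exact ⟨_, s, hs, Fib.id_mem Z⟩
  · rintro ⟨R, r, hr, hFibR⟩
    obtain ⟨E, s, e, hs, -, hFibe⟩ :=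
      exists_isRepresentedBy_insert D k hFib (hk f.right) (hq f) hfS hS hf hr
    refine ⟨E, s, hs, ?_⟩
    rw [← Over.w e]
    exact Fib.comp_mem _ _ hFibe hFibR

end secPsh

end Extension

section PushforwardOfIsRepresentedBy

variable {C : Type u} [Category.{v} C] {A B X : C} {k : X ⟶ B} {p : B ⟶ A}

theorem nonempty_pushforward_of_isRepresentedBy [HasPullbacks C] {T : Over A}
    {u : PullbackHom.{w} p (𝟙 B) k T} (hu : (pullbackHomPsh.{w} p (𝟙 B) k).IsRepresentedBy u) :
    Nonempty (Pushforward k p) := by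
  have hT : IsPullback (pullback.fst T.hom p) (pullback.snd T.hom p) T.hom p := .of_hasPullback _ _
  let m := u.ev _ _ hT.w
  have hm : m ≫ k = pullback.snd T.hom p := (u.ev_comp _ _ _).trans (Category.comp_id _)
  refine ⟨⟨T.left, T.hom, _, _, m, hm ▸ hT, fun {S Y} t y f hY => ?_⟩⟩
  let s : PullbackHom.{w} p (𝟙 B) k (Over.mk t) := .ofHom hY f (Category.comp_id _).symm
  have hs : s.ev y (f ≫ k) hY.w = f := PullbackHom.ofHom_ev_fst_snd hY f _
  have hw (v : S ⟶ T.left) (hv : v ≫ T.hom = t) : (y ≫ v) ≫ T.hom = (f ≫ k) ≫ p := by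
    rw [Category.assoc, hv, hY.w]
  obtain ⟨v, hv⟩ := hu.map_bijective.2 s
  refine ⟨v.left, ⟨Over.w v, hT.lift (y ≫ v.left) (f ≫ k) (hw _ (Over.w v)), hT.lift_fst _ _ _, ?_⟩,
    ?_⟩
  · rw [← u.ev_eq_lift_comp hT]
    exact (congrArg (fun r : PullbackHom.{w} p (𝟙 B) k (Over.mk t) => r.ev y (f ≫ k) hY.w) hv).trans
      hs
  · rintro v' ⟨hv', l, hl, hlf⟩
    have hv'u : u.restrict (Over.homMk v' hv' : Over.mk t ⟶ T) = s := by
      refine PullbackHom.ext_of_isPullback hY (Eq.trans ?_ hs.symm)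
      refine (u.ev_eq_lift_comp hT (y ≫ v') (f ≫ k) (hw v' hv')).trans ?_
      refine Eq.trans ?_ hlf
      congr 1
      refine hT.hom_ext (by rw [hT.lift_fst, hl]) ?_
      rw [hT.lift_snd, ← hm, ← hlf, Category.assoc]
    exact congrArg (fun r => r.left) (hu.map_bijective.1 (hv'u.trans hv.symm))

end PushforwardOfIsRepresentedBy

section PullbackHomApp

variable {I : Type u₁} [Category.{v₁} I] {C : Type u₂} [Category.{v₂} C] [HasPullbacks C]
  {A B X : I ⥤ C} {p : B ⟶ A} {k : X ⟶ B} {T : Over A}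

namespace PullbackHom

variable (u : PullbackHom.{w} p (𝟙 B) k T)

/-- The component at `j` of a map `T ×_A B ⟶ X` of diagrams over `B`. -/
noncomputable def app (j : I) : PullbackHom.{w} (p.app j) (𝟙 (B.obj j)) (k.app j)
    (Over.mk (T.hom.app j)) :=
  have hP := IsPullback.of_hasPullback T.hom p
  ofHom (hP.map ((evaluation I C).obj j)) ((u.ev _ _ hP.w).app j)
    (by simpa using NatTrans.congr_app (u.ev_comp _ _ hP.w) j)

theorem app_ev {Y : I ⥤ C} (x : Y ⟶ T.left) (y : Y ⟶ B) (h : x ≫ T.hom = y ≫ p) (j : I) :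
    (u.app j).ev (x.app j) (y.app j) (NatTrans.congr_app h j) = (u.ev x y h).app j := by
  have hP := IsPullback.of_hasPullback T.hom p
  have hPj := hP.map ((evaluation I C).obj j)
  refine Eq.trans ?_ (congrArg (fun m : Y ⟶ X => m.app j) (u.ev_eq_lift_comp hP x y h)).symm
  refine congrArg (· ≫ (u.ev _ _ hP.w).app j) (hPj.hom_ext ?_ ?_)
  · exact (hPj.lift_fst _ _ _).trans (NatTrans.congr_app (hP.lift_fst x y h) j).symm
  · exact (hPj.lift_snd _ _ _).trans (NatTrans.congr_app (hP.lift_snd x y h) j).symm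

theorem app_ev_map {j j' : I} (g : j ⟶ j') {V : C} (x : V ⟶ T.left.obj j) (y : V ⟶ B.obj j)
    (h : x ≫ T.hom.app j = y ≫ p.app j) :
    (u.app j).ev x y h ≫ X.map g = (u.app j').ev (x ≫ T.left.map g) (y ≫ B.map g)
      (by simp [reassoc_of% h]) := by
  have hP := IsPullback.of_hasPullback T.hom p
  have hPj := hP.map ((evaluation I C).obj j)
  let m := u.ev _ _ hP.w
  calc (u.app j).ev x y h ≫ X.map g
    _ = (hPj.lift x y h ≫ m.app j) ≫ X.map g := rfl
    _ = (hPj.lift x y h ≫ (pullback T.hom p).map g) ≫ m.app j' := by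
      rw [Category.assoc, Category.assoc, NatTrans.naturality]
    _ = _ := (congrArg (_ ≫ ·) (u.app_ev _ _ hP.w j').symm).trans ((u.app j').comp_ev _ _ _ _)
    _ = _ := (u.app j').ev_congr ?_ ?_ _
  · rw [Category.assoc, NatTrans.naturality]
    exact hPj.lift_fst_assoc _ _ _ _
  · rw [Category.assoc, NatTrans.naturality]
    exact hPj.lift_snd_assoc _ _ _ _

theorem ext_app {u u' : PullbackHom.{w} p (𝟙 B) k T} (H : ∀ j, u.app j = u'.app j) : u = u' := by
  refine ext_ev fun x y h => ?_
  ext j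
  rw [← app_ev, H, app_ev]

theorem app_restrict {T' : Over A} (v : T' ⟶ T) (j : I) :
    (u.restrict v).app j = (u.app j).restrict
      (Over.homMk (v.left.app j) (NatTrans.congr_app (Over.w v) j) :
        Over.mk (T'.hom.app j) ⟶ Over.mk (T.hom.app j)) := by
  have hP := IsPullback.of_hasPullback T'.hom p
  exact ext_of_isPullback (hP.map ((evaluation I C).obj j))
    ((app_ev _ _ _ hP.w j).trans (u.app_ev _ _ _ j).symm)

theorem exists_app_eq
    (s : ∀ j, PullbackHom.{w} (p.app j) (𝟙 (B.obj j)) (k.app j) (Over.mk (T.hom.app j)))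
    (hs : ∀ {j j' : I} (g : j ⟶ j') {V : C} (x : V ⟶ T.left.obj j) (y : V ⟶ B.obj j)
      (h : x ≫ T.hom.app j = y ≫ p.app j), (s j).ev x y h ≫ X.map g =
        (s j').ev (x ≫ T.left.map g) (y ≫ B.map g) (by simp [reassoc_of% h])) :
    ∃ u : PullbackHom.{w} p (𝟙 B) k T, ∀ j, u.app j = s j := by
  refine ⟨{ ev := fun x y h =>
              { app := fun j => (s j).ev (x.app j) (y.app j) (NatTrans.congr_app h j)
                naturality := fun j j' g => ?_ }
            ev_comp := fun x y h => ?_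
            comp_ev := fun z x y h => ?_ }, fun j => ?_⟩
  · exact ((s j').comp_ev _ _ _ _).trans ((ev_congr _ (x.naturality g) (y.naturality g) _).trans
      (hs g _ _ _).symm)
  · ext j
    exact (s j).ev_comp _ _ _
  · ext j
    exact (s j).comp_ev _ _ _ _
  · exact ext_of_isPullback ((IsPullback.of_hasPullback T.hom p).map ((evaluation I C).obj j))
      (app_ev _ _ _ pullback.condition j)

end PullbackHom

end PullbackHomApp

section ShapeOfHom

variable {I : Type u₁} [Category.{v₁} I] {C : Type u₂} [Category.{v₂} C] {A B X : I ⥤ C}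

/-- The shape `B_j ⟶ A_j` for `f : i ⟶ j`, with vertex `A_i`. The presheaf of its natural families
over all of `i/I` is represented by `(p_* X)_i`. -/
abbrev Shape.ofHom (p : B ⟶ A) (i : I) : Shape B i (A.obj i) where
  base := { obj f := A.obj f.right, map u := A.map u.right }
  tot := { obj f := B.obj f.right, map u := B.map u.right }
  a f := A.map f.hom
  a_map u := by rw [← A.map_comp, Under.w]
  q f := p.app f.right
  q_map u := p.naturality _
  b f := 𝟙 _
  b_map u := (Category.comp_id _).trans (Category.id_comp _).symm

variable {p : B ⟶ A} {k : X ⟶ B}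

section Shift

variable {i j : I} {S : Set (Under i)} {S' : Set (Under j)} {T : Over (A.obj i)}

/-- The natural family indexed by maps out of `j` obtained by precomposition with `g : i ⟶ j`. -/
@[simps]
def Sec.shift (s : Sec (Shape.ofHom p i) k S T) (g : i ⟶ j)
    (hS : ∀ f ∈ S', Under.mk (g ≫ f.hom) ∈ S) :
    Sec (Shape.ofHom p j) k S' ((Over.map (A.map g)).obj T) where
  val f hf :=
    { ev := fun x y h => (s.val _ (hS f hf)).ev x y (by simpa using h)
      ev_comp := fun x y h => (s.val _ (hS f hf)).ev_comp x y _
      comp_ev := fun z x y h => (s.val _ (hS f hf)).comp_ev z x y _ }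
  natural hf hg u _ x y h :=
    s.natural (hS _ hf) (hS _ hg) (Under.homMk u.right (by simp)) x y (by simpa using h)

end Shift

end ShapeOfHom

section Representing

variable {I : Type u₁} [Category.{v₁} I] {C : Type u₂} [Category.{v₂} C] {B X : I ⥤ C}
  {i : I} {Z : C} {D : Shape B i Z} {k : X ⟶ B} {S : Set (Under i)} {R T : Over Z}
  {r : Sec D k S R} (hr : (secPsh D k S).IsRepresentedBy r)

include hr

theorem Sec.hom_ext_of_isRepresentedBy {V : C} {x x' : V ⟶ R.left}
    (hx : x ≫ R.hom = x' ≫ R.hom)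
    (H : ∀ f (hf : f ∈ S) {V' : C} (z : V' ⟶ V) (y : V' ⟶ D.tot.obj f)
      (h : (z ≫ x) ≫ R.hom ≫ D.a f = y ≫ D.q f),
      (r.val f hf).ev (z ≫ x) y h = (r.val f hf).ev (z ≫ x') y (by
        simpa [reassoc_of% hx] using h)) : x = x' := by
  let t : Over.mk (x ≫ R.hom) ⟶ R := Over.homMk x
  let t' : Over.mk (x ≫ R.hom) ⟶ R := Over.homMk x' hx.symm
  have htt' : r.restrict t = r.restrict t' := ext_ev fun f hf V' z y h => H f hf z y (by
    simpa using h)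
  exact congrArg (fun r => r.left) (hr.map_bijective.1 htt')

theorem Sec.exists_lift_of_isRepresentedBy (s : Sec D k S T) :
    ∃ x : T.left ⟶ R.left, ∃ hx : x ≫ R.hom = T.hom,
      ∀ f (hf : f ∈ S) {V : C} (z : V ⟶ T.left) (y : V ⟶ D.tot.obj f)
        (h : z ≫ T.hom ≫ D.a f = y ≫ D.q f),
        (r.val f hf).ev (z ≫ x) y (by simpa [reassoc_of% hx] using h) = (s.val f hf).ev z y h := by
  obtain ⟨t, rfl⟩ := hr.map_bijective.2 s
  exact ⟨t.left, Over.w t, fun f hf V z y h => rfl⟩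

end Representing

section Pointwise

variable {I : Type u₁} [Category.{v₁} I] {C : Type u₂} [Category.{v₂} C] [HasPullbacks C]
  {A B X : I ⥤ C} {p : B ⟶ A} {k : X ⟶ B} {T : Over A}

namespace PullbackHom

/-- A map `T ×_A B ⟶ X` of diagrams over `B`, seen at `i` as the natural family of the maps
`T_i ×_{A_j} B_j ⟶ T_j ×_{A_j} B_j ⟶ X_j` for `f : i ⟶ j`. -/
@[simps]
noncomputable def sec (u : PullbackHom.{w} p (𝟙 B) k T) (i : I) :
    Sec (Shape.ofHom p i) k Set.univ (Over.mk (T.hom.app i)) where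
  val f _ :=
    { ev := fun x y h => (u.app f.right).ev (x ≫ T.left.map f.hom) y (by
        simpa using h)
      ev_comp := fun x y h => (u.app f.right).ev_comp _ _ _
      comp_ev := fun z x y h => ((u.app f.right).comp_ev _ _ _ _).trans
        (ev_congr _ (Category.assoc _ _ _).symm rfl _) }
  natural {f g} _ _ v _ x y h := by
    refine (u.app_ev_map _ _ _ _).trans (ev_congr _ ?_ rfl _)
    rw [Category.assoc, ← Functor.map_comp, Under.w v]

theorem sec_restrict {T' : Over A} (v : T' ⟶ T) (u : PullbackHom.{w} p (𝟙 B) k T) (i : I) :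
    (u.restrict v).sec i = (u.sec i).restrict
      (Over.homMk (v.left.app i) (NatTrans.congr_app (Over.w v) i) :
        Over.mk (T'.hom.app i) ⟶ Over.mk (T.hom.app i)) := by
  refine Sec.ext_ev fun f _ V x y h => ?_
  rw [sec_val_ev, app_restrict]
  exact (u.app f.right).ev_congr ((Category.assoc _ _ _).trans
    ((congrArg (x ≫ ·) (v.left.naturality f.hom)).trans (Category.assoc _ _ _).symm)) rfl _

section IsRepresentedBy

variable {u : PullbackHom.{w} p (𝟙 B) k T}

theorem hom_ext_of_isRepresentedBy_sec {j : I}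
    (hu : (secPsh (Shape.ofHom p j) k Set.univ).IsRepresentedBy (u.sec j)) {V : C}
    {x x' : V ⟶ T.left.obj j} (hx : x ≫ T.hom.app j = x' ≫ T.hom.app j)
    (H : ∀ {l : I} (f : j ⟶ l) {V' : C} (z : V' ⟶ V) (y : V' ⟶ B.obj l)
      (h : (z ≫ x ≫ T.left.map f) ≫ T.hom.app l = y ≫ p.app l)
      (h' : (z ≫ x' ≫ T.left.map f) ≫ T.hom.app l = y ≫ p.app l),
      (u.app l).ev (z ≫ x ≫ T.left.map f) y h = (u.app l).ev (z ≫ x' ≫ T.left.map f) y h') :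
    x = x' := by
  refine Sec.hom_ext_of_isRepresentedBy hu hx fun f hf V' z y h => ?_
  have hzx : (z ≫ x ≫ T.left.map f.hom) ≫ T.hom.app f.right = y ≫ p.app f.right := by
    simpa using h
  have hzx' : (z ≫ x' ≫ T.left.map f.hom) ≫ T.hom.app f.right = y ≫ p.app f.right := by
    rw [← hzx]
    simp [← reassoc_of% hx]
  exact ((u.app f.right).ev_congr (Category.assoc _ _ _) rfl _).trans ((H f.hom z y hzx hzx').trans
    ((u.app f.right).ev_congr (Category.assoc _ _ _).symm rfl _))

theorem exists_lift_of_isRepresentedBy_sec {j : I}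
    (hu : (secPsh (Shape.ofHom p j) k Set.univ).IsRepresentedBy (u.sec j)) {R : Over (A.obj j)}
    (s : Sec (Shape.ofHom p j) k Set.univ R) :
    ∃ x : R.left ⟶ T.left.obj j, x ≫ T.hom.app j = R.hom ∧
      ∀ (f : Under j) {V : C} (z : V ⟶ R.left) (y : V ⟶ B.obj f.right)
        (h : (z ≫ x ≫ T.left.map f.hom) ≫ T.hom.app f.right = y ≫ p.app f.right)
        (h' : z ≫ R.hom ≫ A.map f.hom = y ≫ p.app f.right),
        (u.app f.right).ev (z ≫ x ≫ T.left.map f.hom) y h = (s.val f trivial).ev z y h' := by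
  obtain ⟨x, hx, hxs⟩ := Sec.exists_lift_of_isRepresentedBy hu s
  exact ⟨x, hx, fun f V z y h h' =>
    ((u.app f.right).ev_congr (Category.assoc _ _ _).symm rfl _).trans (hxs f trivial z y h')⟩

theorem exists_restrict_eq_of_isRepresentedBy_sec
    (hu : ∀ i, (secPsh (Shape.ofHom p i) k Set.univ).IsRepresentedBy (u.sec i)) {T' : Over A}
    (u' : PullbackHom.{w} p (𝟙 B) k T') : ∃ v : T' ⟶ T, u.restrict v = u' := by
  choose v hv hvu using fun i => exists_lift_of_isRepresentedBy_sec (hu i) (u'.sec i)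
  have hv (i : I) : v i ≫ T.hom.app i = T'.hom.app i := hv i
  have hvu {i j : I} (f : i ⟶ j) {V : C} (z : V ⟶ T'.left.obj i) (y : V ⟶ B.obj j)
      (h : (z ≫ v i ≫ T.left.map f) ≫ T.hom.app j = y ≫ p.app j)
      (h' : (z ≫ T'.left.map f) ≫ T'.hom.app j = y ≫ p.app j) :
      (u.app j).ev (z ≫ v i ≫ T.left.map f) y h = (u'.app j).ev (z ≫ T'.left.map f) y h' :=
    hvu i (Under.mk f) z y h (by simpa using h')
  have naturality {i j : I} (g : i ⟶ j) : T'.left.map g ≫ v j = v i ≫ T.left.map g := by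
    refine hom_ext_of_isRepresentedBy_sec (hu j) (by simp [hv, reassoc_of% hv])
      fun {l} f V z y h h' => ?_
    have hz : ((z ≫ T'.left.map g) ≫ T'.left.map f) ≫ T'.hom.app l = y ≫ p.app l := by
      simpa [reassoc_of% hv] using h'
    calc _ = (u'.app l).ev ((z ≫ T'.left.map g) ≫ T'.left.map f) y hz := by
            rw [← hvu f _ y (by simpa using h)]
            exact (u.app l).ev_congr (by simp) rfl _
      _ = (u'.app l).ev (z ≫ T'.left.map (g ≫ f)) y (by simpa using hz) :=
        (u'.app l).ev_congr (by simp) rfl _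
      _ = _ := by
        rw [← hvu (g ≫ f) z y (by simpa using h')]
        exact (u.app l).ev_congr (by simp) rfl _
  let t : T' ⟶ T := Over.homMk { app := v, naturality := fun _ _ g => naturality g } (by
    ext i
    exact hv i)
  refine ⟨t, ext_app fun j => (app_restrict u t j).trans (ext_ev fun {V : C} x y h => ?_)⟩
  have hx (Q : I ⥤ C) (z : V ⟶ Q.obj j) : z ≫ Q.map (𝟙 j) = z := by simp
  have hxy : x ≫ T'.hom.app j = y ≫ p.app j := h
  have hvxy : (x ≫ v j) ≫ T.hom.app j = y ≫ p.app j := by rw [Category.assoc, hv, hxy]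
  have hid : x ≫ v j ≫ T.left.map (𝟙 j) = x ≫ v j := congrArg (x ≫ ·) (by simp)
  exact ((u.app j).ev_congr hid.symm rfl hvxy).trans
    ((hvu (𝟙 j) x y (by rw [hid, hvxy]) (by rw [hx, hxy])).trans
      ((u'.app j).ev_congr (hx _ _) rfl _))

theorem isRepresentedBy_of_sec
    (hu : ∀ i, (secPsh (Shape.ofHom p i) k Set.univ).IsRepresentedBy (u.sec i)) :
    (pullbackHomPsh.{w} p (𝟙 B) k).IsRepresentedBy u where
  map_bijective {T'} := by
    refine ⟨fun v v' hvv' => ?_, exists_restrict_eq_of_isRepresentedBy_sec hu⟩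
    have hsec (i : I) := (sec_restrict v u i).symm.trans
      ((congrArg (fun u' => sec u' i) hvv').trans (sec_restrict v' u i))
    ext i
    exact congrArg (fun r => r.left) ((hu i).map_bijective.1 (hsec i))

end IsRepresentedBy

end PullbackHom

end Pointwise

section OfPointwise

variable {I : Type u₁} [Category.{v₁} I] {C : Type u₂} [Category.{v₂} C] {A B X : I ⥤ C}
  {p : B ⟶ A} {k : X ⟶ B}

theorem Sec.ev_hom_congr {i j : I} {S : Set (Under i)} {T : Over (A.obj i)}
    (s : Sec (Shape.ofHom p i) k S T) {f f' : i ⟶ j} (hff' : f = f') (hf : Under.mk f ∈ S)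
    {V : C} {x : V ⟶ T.left} {y : V ⟶ B.obj j} (h : x ≫ T.hom ≫ A.map f = y ≫ p.app j) :
    (s.val (Under.mk f) hf).ev x y h =
      (s.val (Under.mk f') (hff' ▸ hf)).ev x y (by rwa [← hff']) := by
  subst hff'
  rfl

section ExistsSec

variable {R : ∀ i, Over (A.obj i)} {r : ∀ i, Sec (Shape.ofHom p i) k Set.univ (R i)}
  (hr : ∀ i, (secPsh (Shape.ofHom p i) k Set.univ).IsRepresentedBy (r i))

include hr

theorem Sec.exists_map_shift : ∃ map : ∀ {i j : I}, (i ⟶ j) → ((R i).left ⟶ (R j).left),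
    (∀ {i j : I} (g : i ⟶ j), map g ≫ (R j).hom = (R i).hom ≫ A.map g) ∧
    ∀ {i j l : I} (g : i ⟶ j) (f : j ⟶ l) {V : C} (z : V ⟶ (R i).left) (y : V ⟶ B.obj l)
      (h : z ≫ (R i).hom ≫ A.map (g ≫ f) = y ≫ p.app l)
      (h' : (z ≫ map g) ≫ (R j).hom ≫ A.map f = y ≫ p.app l),
      ((r j).val (Under.mk f) trivial).ev (z ≫ map g) y h' =
        ((r i).val (Under.mk (g ≫ f)) trivial).ev z y h := by
  choose map hmap hev using fun i j (g : i ⟶ j) =>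
    Sec.exists_lift_of_isRepresentedBy (hr j) ((r i).shift g fun _ _ => trivial)
  exact ⟨fun g => map _ _ g, fun g => hmap _ _ g, fun g f V z y h _ =>
    hev _ _ g (Under.mk f) trivial z y (by simpa using h)⟩

variable {map : ∀ {i j : I}, (i ⟶ j) → ((R i).left ⟶ (R j).left)}
  (hmap : ∀ {i j : I} (g : i ⟶ j), map g ≫ (R j).hom = (R i).hom ≫ A.map g)
  (hev : ∀ {i j l : I} (g : i ⟶ j) (f : j ⟶ l) {V : C} (z : V ⟶ (R i).left) (y : V ⟶ B.obj l)
    (h : z ≫ (R i).hom ≫ A.map (g ≫ f) = y ≫ p.app l)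
    (h' : (z ≫ map g) ≫ (R j).hom ≫ A.map f = y ≫ p.app l),
    ((r j).val (Under.mk f) trivial).ev (z ≫ map g) y h' =
      ((r i).val (Under.mk (g ≫ f)) trivial).ev z y h)

include hmap hev

theorem Sec.map_id_of_shift (i : I) : map (𝟙 i) = 𝟙 _ := by
  refine Sec.hom_ext_of_isRepresentedBy (hr i) (by simp [hmap]) fun f _ V z y h => ?_
  have hz : z ≫ (R i).hom ≫ A.map (𝟙 i ≫ f.hom) = y ≫ p.app f.right := by
    simpa [reassoc_of% (hmap (𝟙 i))] using h
  calc _ = _ := hev (𝟙 i) f.hom z y hz h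
    _ = _ := (r i).ev_hom_congr (Category.id_comp f.hom) _ _
    _ = _ := ((r i).val f trivial).ev_congr (Category.comp_id z).symm rfl _

theorem Sec.map_comp_of_shift {i j l : I} (g : i ⟶ j) (g' : j ⟶ l) :
    map (g ≫ g') = map g ≫ map g' := by
  refine Sec.hom_ext_of_isRepresentedBy (hr l) (by simp [hmap, reassoc_of% (hmap g)])
    fun f _ V z y h => ?_
  have hz : z ≫ (R i).hom ≫ A.map (g ≫ g' ≫ f.hom) = y ≫ p.app f.right := by
    simpa [reassoc_of% (hmap (g ≫ g'))] using h
  calc _ = _ := hev (g ≫ g') f.hom z y (by simpa using hz) h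
    _ = _ := (r i).ev_hom_congr (Category.assoc g g' f.hom) _ _
    _ = _ := (hev g (g' ≫ f.hom) z y hz (by simpa [reassoc_of% (hmap g)] using hz)).symm
    _ = _ := (hev g' f.hom (z ≫ map g) y (by simpa [reassoc_of% (hmap g)] using hz)
        (by simpa [reassoc_of% (hmap g), reassoc_of% (hmap g')] using hz)).symm
    _ = _ := PullbackHom.ev_congr _ (Category.assoc _ _ _) rfl _

omit hmap hev in
theorem PullbackHom.exists_sec_isRepresentedBy [HasPullbacks C] :
    ∃ (T : Over A) (u : PullbackHom.{max u₁ v₁} p (𝟙 B) k T),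
      ∀ i, (secPsh (Shape.ofHom p i) k Set.univ).IsRepresentedBy (u.sec i) := by
  obtain ⟨map, hmap, hev⟩ := Sec.exists_map_shift hr
  let Q : I ⥤ C :=
    { obj i := (R i).left
      map g := map g
      map_id := Sec.map_id_of_shift hr hmap hev
      map_comp := Sec.map_comp_of_shift hr hmap hev }
  let T : Over A := Over.mk ({ app i := (R i).hom, naturality _ _ g := hmap g } : Q ⟶ A)
  have hid {j : I} {V : C} (x : V ⟶ (R j).left) {y : V ⟶ B.obj j}
      (h : x ≫ (R j).hom = y ≫ p.app j) : x ≫ (R j).hom ≫ A.map (𝟙 j) = y ≫ p.app j := by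
    simpa using h
  let v (j : I) : PullbackHom (p.app j) (𝟙 (B.obj j)) (k.app j) (Over.mk (T.hom.app j)) :=
    { ev x y h := ((r j).val (Under.mk (𝟙 j)) trivial).ev x y (hid x h)
      ev_comp x y h := ((r j).val (Under.mk (𝟙 j)) trivial).ev_comp x y (hid x h)
      comp_ev z x y h := ((r j).val (Under.mk (𝟙 j)) trivial).comp_ev z x y (hid x h) }
  have hv {i j : I} (f : i ⟶ j) {V : C} (x : V ⟶ (R i).left) (y : V ⟶ B.obj j)
      (h : x ≫ (R i).hom ≫ A.map f = y ≫ p.app j) (h' : (x ≫ map f) ≫ (R j).hom = y ≫ p.app j) :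
      (v j).ev (x ≫ map f) y h' = ((r i).val (Under.mk f) trivial).ev x y h :=
    (hev f (𝟙 j) x y (by simpa using h) _).trans
      ((r i).ev_hom_congr (Category.comp_id _) _ _)
  obtain ⟨u, hu⟩ := PullbackHom.exists_app_eq v fun {i j} g V x y h => by
    have hg := (r i).natural (f := Under.mk (𝟙 i)) (g := Under.mk g) trivial trivial
      (Under.homMk g) x y (hid x h)
    exact hg.trans (hv g x (y ≫ B.map g) _ _).symm
  refine ⟨T, u, fun i => ?_⟩
  have hsec : u.sec i = r i := Sec.ext_ev fun f _ V x y h => by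
    rw [PullbackHom.sec_val_ev, hu]
    exact hv f.hom x y h _
  rw [hsec]
  exact hr i

end ExistsSec

end OfPointwise

section RelMatching

variable {I : Type u₁} [Category.{v₁} I] [∀ i : I, Finite (Under i)] {C : Type u₂}
  [Category.{v₂} C] [HasFiniteLimits C] {A B X : I ⥤ C} {p : B ⟶ A} {k : X ⟶ B} {T : Over A}

namespace PullbackHom

/-- The natural family indexed by the non-identity maps `f : i ⟶ j` of the maps
`(A_i ×_{M_i A} M_i T) ×_{A_j} B_j ⟶ T_j ×_{A_j} B_j ⟶ X_j`. -/
@[simps]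
noncomputable def relMatchingSec (u : PullbackHom.{w} p (𝟙 B) k T) (i : I) :
    Sec (Shape.ofHom p i) k {f | f ≠ Under.mk (𝟙 i)} (Over.mk (relMatchingFst T.hom i)) where
  val f hf :=
    { ev := fun x y h => (u.app f.right).ev (x ≫ relMatchingπ T.hom ⟨f, hf⟩) y (by
        rw [Category.assoc]
        exact (congrArg (x ≫ ·) (relMatchingπ_app (k := T.hom) ⟨f, hf⟩)).trans h)
      ev_comp := fun x y h => (u.app f.right).ev_comp _ _ _
      comp_ev := fun z x y h => ((u.app f.right).comp_ev _ _ _ _).trans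
        (ev_congr _ (Category.assoc _ _ _).symm rfl _) }
  natural {f g} hf hg v _ x y h := by
    refine (u.app_ev_map _ _ _ _).trans (ev_congr _ ?_ rfl _)
    rw [Category.assoc]
    exact congrArg (x ≫ ·) (relMatchingπ_map (k := T.hom) (h := ⟨f, hf⟩) (h' := ⟨g, hg⟩)
      (ObjectProperty.homMk v))

variable {u : PullbackHom.{w} p (𝟙 B) k T}

theorem restrictSet_sec (i : I) :
    (u.sec i).restrictSet (Set.subset_univ {f | f ≠ Under.mk (𝟙 i)}) =
      (u.relMatchingSec i).restrict (Over.homMk (relMatchingMap T.hom i) relMatchingMap_fst :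
        Over.mk (T.hom.app i) ⟶ Over.mk (relMatchingFst T.hom i)) := by
  refine Sec.ext_ev fun f hf V x y h => (u.app f.right).ev_congr ?_ rfl _
  exact (congrArg (x ≫ ·) (relMatchingMap_π (k := T.hom) ⟨f, hf⟩)).symm.trans
    (Category.assoc _ _ _).symm

variable [IsInverse I] {i : I}

theorem relMatchingπ_comp_map (h : Boundary i) {l : I} (f : h.obj.right ⟶ l) :
    relMatchingπ T.hom h ≫ T.left.map f =
      relMatchingπ T.hom ⟨Under.mk (h.obj.hom ≫ f), underMk_comp_ne h f⟩ :=
  relMatchingπ_map (k := T.hom) (h := h) (h' := ⟨Under.mk (h.obj.hom ≫ f), underMk_comp_ne h f⟩)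
    (ObjectProperty.homMk (Under.homMk f))

section IsRepresentedBy

variable (hu : ∀ i, (secPsh (Shape.ofHom p i) k Set.univ).IsRepresentedBy (u.sec i))

include hu

theorem relMatchingSec_restrict_injective {T' : Over (A.obj i)} :
    Function.Injective fun v : T' ⟶ Over.mk (relMatchingFst T.hom i) =>
      (u.relMatchingSec i).restrict v := fun v v' hvv' => by
  have hfst : v.left ≫ relMatchingFst T.hom i = v'.left ≫ relMatchingFst T.hom i :=
    (Over.w v).trans (Over.w v').symm
  refine Over.OverMorphism.ext (relMatchingObj_hom_ext hfst fun h => ?_)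
  refine hom_ext_of_isRepresentedBy_sec (hu h.obj.right) ?_ fun {l} f V z y hz hz' => ?_
  · simp [relMatchingπ_app, reassoc_of% hfst]
  · let f' : Under i := Under.mk (h.obj.hom ≫ f)
    have hπ (v : T' ⟶ Over.mk (relMatchingFst T.hom i)) :
        z ≫ (v.left ≫ relMatchingπ T.hom h) ≫ T.left.map f =
          (z ≫ v.left) ≫ relMatchingπ T.hom ⟨f', underMk_comp_ne h f⟩ := by
      simp [relMatchingπ_comp_map, f']
    have hzy : z ≫ T'.hom ≫ A.map (h.obj.hom ≫ f) = y ≫ p.app l := by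
      have hv : v.left ≫ relMatchingFst T.hom i = T'.hom := Over.w v
      rw [← hz, A.map_comp, ← hv]
      simp only [Category.assoc, NatTrans.naturality,
        reassoc_of% (relMatchingπ_app (k := T.hom) h)]
    have h := congrArg (fun s : Sec (Shape.ofHom p i) k _ T' =>
      (s.val f' (underMk_comp_ne h f)).ev z y hzy) hvv'
    exact ((u.app l).ev_congr (hπ v) rfl _).trans (h.trans ((u.app l).ev_congr (hπ v').symm rfl _))

theorem exists_relMatchingSec_restrict_eq {T' : Over (A.obj i)}
    (s : Sec (Shape.ofHom p i) k {f | f ≠ Under.mk (𝟙 i)} T') :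
    ∃ v : T' ⟶ Over.mk (relMatchingFst T.hom i), (u.relMatchingSec i).restrict v = s := by
  choose x hx hxs using fun h : Boundary i => exists_lift_of_isRepresentedBy_sec
    (hu h.obj.right) (s.shift h.obj.hom fun f _ => underMk_comp_ne h f.hom)
  have hcompat (h h' : Boundary i) (φ : h ⟶ h') : x h ≫ T.left.map φ.hom.right = x h' := by
    have hφ : h.obj.hom ≫ φ.hom.right = h'.obj.hom := Under.w φ.hom
    have hAφ : A.map h.obj.hom ≫ A.map φ.hom.right = A.map h'.obj.hom := by rw [← hφ, A.map_comp]
    refine hom_ext_of_isRepresentedBy_sec (hu h'.obj.right) ?_ fun {l} f V z y hz hz' => ?_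
    · rw [Category.assoc, NatTrans.naturality, reassoc_of% hx, hx]
      exact (Category.assoc _ _ _).trans (congrArg (T'.hom ≫ ·) hAφ)
    · have hz : (z ≫ x h ≫ T.left.map (φ.hom.right ≫ f)) ≫ T.hom.app l = y ≫ p.app l := by
        simpa using hz
      have hT' : z ≫ T'.hom ≫ A.map (h'.obj.hom ≫ f) = y ≫ p.app l := by
        rw [← hz']
        simp [reassoc_of% hx]
      have hT'φ : z ≫ T'.hom ≫ A.map (h.obj.hom ≫ φ.hom.right ≫ f) = y ≫ p.app l := by
        rw [← hT', reassoc_of% hφ]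
      calc _ = _ := (u.app l).ev_congr (by simp) rfl _
        _ = _ := hxs h (Under.mk (φ.hom.right ≫ f)) z y hz (by
          simpa [reassoc_of% hAφ] using hT')
        _ = _ := s.ev_hom_congr (by rw [reassoc_of% hφ]; rfl) (underMk_comp_ne _ _) hT'φ
        _ = _ := (hxs h' (Under.mk f) z y hz' (by simpa using hT')).symm
  obtain ⟨t, ht, htx⟩ := exists_relMatchingObj_lift (k := T.hom) (j := i) T'.hom x hcompat hx
  refine ⟨Over.homMk t ht, Sec.ext_ev fun f hf V z y h => ?_⟩
  have hz : z ≫ T'.hom ≫ A.map f.hom = y ≫ p.app f.right := h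
  have hf1 := hxs ⟨f, hf⟩ (Under.mk (𝟙 _)) z y (by simpa [hx] using hz) (by simpa using hz)
  have hs := s.ev_hom_congr (x := z) (y := y) (Category.comp_id f.hom)
    (underMk_comp_ne ⟨f, hf⟩ (𝟙 _)) (by simpa using hz)
  refine Eq.trans ?_ (hf1.trans hs)
  refine (u.app f.right).ev_congr ?_ rfl _
  simp [← htx]

theorem isRepresentedBy_relMatchingSec :
    (secPsh (Shape.ofHom p i) k {f | f ≠ Under.mk (𝟙 i)}).IsRepresentedBy
      (u.relMatchingSec i) where
  map_bijective := ⟨relMatchingSec_restrict_injective hu, exists_relMatchingSec_restrict_eq hu⟩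

end IsRepresentedBy

end PullbackHom

end RelMatching

/-- A map is its own pushforward along the identity. -/
noncomputable def Pushforward.ofId {D : Type*} [Category* D] {X B : D} (k : X ⟶ B) :
    Pushforward k (𝟙 B) where
  obj := X
  hom := k
  pb := X
  proj := 𝟙 X
  ev := 𝟙 X
  isPullback := by
    rw [Category.id_comp]
    exact IsPullback.of_horiz_isIso ⟨by simp⟩
  existsUnique_transpose {T Y} t y u h := by
    have : IsIso y := h.isIso_fst_of_isIso
    refine ⟨inv y ≫ u, ⟨?_, u, by simp, by simp⟩, ?_⟩
    · rw [Category.assoc, IsIso.inv_comp_eq, h.w, Category.comp_id]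
    · rintro v ⟨-, w, h₁, h₂⟩
      rw [IsIso.eq_inv_comp, ← h₁, ← h₂]

section ReedyPushforward

variable {I : Type u₁} [Category.{v₁} I] [∀ i : I, Finite (Under i)] {C : Type u₂}
  [Category.{v₂} C] [HasFiniteLimits C] {Fib : MorphismProperty C}
  [Fib.IsStableUnderBaseChange] (hFib : FibrationsStableUnderPushforward Fib) {A B X : I ⥤ C}
  {p : B ⟶ A} {k : X ⟶ B}

include hFib

namespace secPsh

variable {i : I} {Z : C} {D : Shape B i Z} {S : Set (Under i)}

theorem representedIn_restrictSet {S' : Set (Under i)} {f : Under i} (hfS : f ∉ S)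
    (hS : IsCosieve S) (hf : ∀ h : Boundary f.right, extend f h ∈ S) (hS' : S' = insert f S)
    (hSS' : S ⊆ S') {R : Over Z} {r : Sec D k S R} (hr : (secPsh D k S).IsRepresentedBy r)
    (hk : Fib (relMatchingMap k f.right)) (hq : Fib (D.q f)) :
    RepresentedIn Fib.over (restrictSet D k hSS') := by
  subst hS'
  obtain ⟨E, s, e, hs, he, hFibe⟩ := exists_isRepresentedBy_insert D k hFib hk hq hfS hS hf hr
  exact he.representedIn hs hr hFibe

variable [IsInverse I] [Fib.IsMultiplicative]

theorem fib_hom {R : Over Z} {r : Sec D k S R} (hr : (secPsh D k S).IsRepresentedBy r)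
    (hk : IsReedyFibration Fib k) (hq : ∀ f, Fib (D.q f)) (hS : IsCosieve S) : Fib R.hom := by
  obtain ⟨E, s, hs, hE⟩ := exists_isRepresentedBy D k hFib hk hq hS
  obtain ⟨e, he⟩ := exists_represents hs (𝟙 _) r
  have : IsIso e := he.isIso hr hs
  exact (Fib.arrow_mk_iso_iff
    (Arrow.isoMk ((Over.forget Z).mapIso (asIso e)) (Iso.refl _) (by simp))).2 hE

end secPsh

variable [IsInverse I] [Fib.IsMultiplicative]

section PointwiseFibration

variable (hk : IsReedyFibration Fib k) (hp : ∀ i, Fib (p.app i))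

include hk hp

theorem PullbackHom.exists_sec_isRepresentedBy_of_reedy :
    ∃ (T : Over A) (u : PullbackHom.{max u₁ v₁} p (𝟙 B) k T),
      ∀ i, (secPsh (Shape.ofHom p i) k Set.univ).IsRepresentedBy (u.sec i) := by
  choose R r hr _ using fun i => secPsh.exists_isRepresentedBy (Shape.ofHom p i) k hFib hk
    (fun f => hp f.right) (isCosieve_univ i)
  exact PullbackHom.exists_sec_isRepresentedBy hr

theorem nonempty_pushforward_of_reedy : Nonempty (Pushforward k p) := by
  obtain ⟨T, u, hu⟩ := PullbackHom.exists_sec_isRepresentedBy_of_reedy hFib hk hp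
  exact nonempty_pushforward_of_isRepresentedBy (PullbackHom.isRepresentedBy_of_sec hu)

namespace Pushforward

variable (P : Pushforward k p)

theorem isRepresentedBy_sec_evHom (i : I) :
    (secPsh (Shape.ofHom p i) k Set.univ).IsRepresentedBy ((evHom.{max u₁ v₁} P).sec i) := by
  obtain ⟨T, u, hu⟩ := PullbackHom.exists_sec_isRepresentedBy_of_reedy hFib hk hp
  have hu' := PullbackHom.isRepresentedBy_of_sec hu
  obtain ⟨e, he⟩ := exists_represents hu' (𝟙 _) (evHom.{max u₁ v₁} P)
  have : IsIso e := he.isIso P.isRepresentedBy_evHom hu'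
  have heu : u.restrict e = P.evHom := he
  rw [← heu, PullbackHom.sec_restrict]
  exact (hu i).of_isoObj ((Over.post ((evaluation I C).obj i)).mapIso (asIso e))

theorem fib_hom_app (i : I) : Fib (P.hom.app i) :=
  secPsh.fib_hom hFib (P.isRepresentedBy_sec_evHom hFib hk hp i) hk (fun f => hp f.right)
    (isCosieve_univ i)

theorem fib_relMatchingFst (i : I) : Fib (relMatchingFst P.hom i) :=
  secPsh.fib_hom hFib
    (PullbackHom.isRepresentedBy_relMatchingSec (P.isRepresentedBy_sec_evHom hFib hk hp)) hk
    (fun f => hp f.right) (isCosieve_boundary i)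

theorem isReedyFibration_hom : IsReedyFibration Fib P.hom := by
  intro i
  have hu := P.isRepresentedBy_sec_evHom hFib hk hp
  have huniv : Set.univ = insert (Under.mk (𝟙 i)) {f | f ≠ Under.mk (𝟙 i)} := by
    ext f
    simpa using em (f = Under.mk (𝟙 i))
  exact secPsh.representedIn_restrictSet hFib (not_not.2 rfl) (isCosieve_boundary i)
    (fun h => by simpa [extend] using underMk_comp_ne h (𝟙 _)) huniv (Set.subset_univ _)
    (PullbackHom.isRepresentedBy_relMatchingSec hu) (hk i) (hp i) (hu i)
    (PullbackHom.isRepresentedBy_relMatchingSec hu) (PullbackHom.restrictSet_sec i).symm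

end Pushforward

end PointwiseFibration

namespace IsReedyFibration

variable (hk : IsReedyFibration Fib k)

include hk

theorem fib_app (i : I) : Fib (k.app i) :=
  (Pushforward.ofId k).fib_hom_app hFib hk (fun _ => Fib.id_mem _) i

theorem fib_relMatchingFst (i : I) : Fib (relMatchingFst k i) :=
  (Pushforward.ofId k).fib_relMatchingFst hFib hk (fun _ => Fib.id_mem _) i

end IsReedyFibration

end ReedyPushforward

section Cogluing

variable {C : Type u} [Category.{v} C] [HasPullbacks C] {Fib W : MorphismProperty C}
  [Fib.IsStableUnderBaseChange] [W.HasTwoOutOfThreeProperty] (hpb : PullbacksLogicallyBehaved Fib W)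

include hpb

namespace PullbacksLogicallyBehaved

/- The map factors as `X ×_Z Y ⟶ (X' ×_{Z'} Z) ×_Z Y ⟶ X' ×_{Z'} Y'`: a pullback of a weak
equivalence between fibrations over `Z`, followed by a pullback of `β` along a fibration. -/
theorem weq_of_cospan {P X Y Z P' X' Y' Z' : C} {p₁ : P ⟶ X} {p₂ : P ⟶ Y}
    {x : X ⟶ Z} {y : Y ⟶ Z} {p₁' : P' ⟶ X'} {p₂' : P' ⟶ Y'} {x' : X' ⟶ Z'} {y' : Y' ⟶ Z'}
    (h : IsPullback p₁ p₂ x y) (h' : IsPullback p₁' p₂' x' y') (hx : Fib x) (hx' : Fib x')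
    {α : X ⟶ X'} {β : Y ⟶ Y'} {γ : Z ⟶ Z'} {δ : P ⟶ P'} (hα : W α) (hβ : W β) (hγ : W γ)
    (hαγ : x ≫ γ = α ≫ x') (hβγ : y ≫ γ = β ≫ y') (h₁ : p₁ ≫ α = δ ≫ p₁')
    (h₂ : p₂ ≫ β = δ ≫ p₂') : W δ := by
  have hQ := IsPullback.of_hasPullback x' γ
  have hq : Fib (pullback.snd x' γ) := Fib.of_isPullback hQ hx'
  let a : X ⟶ pullback x' γ := hQ.lift α x hαγ.symm
  have ha₁ : a ≫ pullback.fst x' γ = α := hQ.lift_fst _ _ _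
  have ha₂ : a ≫ pullback.snd x' γ = x := hQ.lift_snd _ _ _
  have ha : W a := W.of_postcomp _ _ (hpb.weq_of_isPullback hQ hx' hγ) (by rwa [ha₁])
  have hR := IsPullback.of_hasPullback (pullback.snd x' γ) y
  have hl := hpb.weq_pullback h hR a ha₂ hx hq ha
  have hRQ := hR.paste_horiz hQ
  rw [hβγ] at hRQ
  let m : pullback (pullback.snd x' γ) y ⟶ P' :=
    h'.lift (pullback.fst _ _ ≫ pullback.fst _ _) (pullback.snd _ _ ≫ β)
      (by rw [hRQ.w, Category.assoc])
  have hm₁ : m ≫ p₁' = _ := h'.lift_fst _ _ _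
  have hm₂ : m ≫ p₂' = _ := h'.lift_snd _ _ _
  have hm : IsPullback m (pullback.snd _ y) p₂' β := .of_right (by rwa [hm₁]) hm₂ h'
  have hmW : W m := hpb.weq_of_isPullback hm (Fib.of_isPullback h' hx') hβ
  obtain rfl : δ = hR.lift (p₁ ≫ a) p₂ (by rw [Category.assoc, ha₂, h.w]) ≫ m := by
    apply h'.hom_ext
    · rw [← h₁, Category.assoc, hm₁, hR.lift_fst_assoc, Category.assoc, ha₁]
    · rw [← h₂, Category.assoc, hm₂, hR.lift_snd_assoc]
  exact W.comp_mem _ _ hl hmW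

theorem representedIn_of_isPullback {Z : C} {F G K M F' G' K' M' : (Over Z)ᵒᵖ ⥤ Type w}
    [G.IsRepresentable] [K.IsRepresentable] [M.IsRepresentable] [G'.IsRepresentable]
    [K'.IsRepresentable] [M'.IsRepresentable] {π : F ⟶ G} {ψ : F ⟶ K} {φ : G ⟶ M} {χ : K ⟶ M}
    {π' : F' ⟶ G'} {ψ' : F' ⟶ K'} {φ' : G' ⟶ M'} {χ' : K' ⟶ M'} (H : IsPullback π ψ φ χ)
    (H' : IsPullback π' ψ' φ' χ') (hχ : RepresentedIn Fib.over χ) (hχ' : RepresentedIn Fib.over χ')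
    {α : F ⟶ F'} {β : G ⟶ G'} {κ : K ⟶ K'} {μ : M ⟶ M'} (hβ : RepresentedIn W.over β)
    (hκ : RepresentedIn W.over κ) (hμ : RepresentedIn W.over μ) (hαβ : π ≫ β = α ≫ π')
    (hακ : ψ ≫ κ = α ≫ ψ') (hβμ : φ ≫ μ = β ≫ φ') (hκμ : χ ≫ μ = κ ≫ χ') :
    RepresentedIn W.over α := by
  intro R R' x y e hF hF' he
  have hG := Functor.IsRepresentedBy.of_isRepresentable (F := G)
  have hK := Functor.IsRepresentedBy.of_isRepresentable (F := K)
  have hM := Functor.IsRepresentedBy.of_isRepresentable (F := M)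
  have hG' := Functor.IsRepresentedBy.of_isRepresentable (F := G')
  have hK' := Functor.IsRepresentedBy.of_isRepresentable (F := K')
  have hM' := Functor.IsRepresentedBy.of_isRepresentable (F := M')
  obtain ⟨_, hπ⟩ := exists_represents hG π x
  obtain ⟨_, hψ⟩ := exists_represents hK ψ x
  obtain ⟨_, hφ⟩ := exists_represents hM φ G.reprx
  obtain ⟨_, hrχ⟩ := exists_represents hM χ K.reprx
  obtain ⟨_, hπ'⟩ := exists_represents hG' π' y
  obtain ⟨_, hψ'⟩ := exists_represents hK' ψ' y
  obtain ⟨_, hφ'⟩ := exists_represents hM' φ' G'.reprx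
  obtain ⟨_, hrχ'⟩ := exists_represents hM' χ' K'.reprx
  obtain ⟨_, hrβ⟩ := exists_represents hG' β G.reprx
  obtain ⟨_, hrκ⟩ := exists_represents hK' κ K.reprx
  obtain ⟨_, hrμ⟩ := exists_represents hM' μ M.reprx
  have hR := (Represents.isPullback H hF hG hK hM hπ hψ hφ hrχ).flip.map (Over.forget Z)
  have hR' := (Represents.isPullback H' hF' hG' hK' hM' hπ' hψ' hφ' hrχ').flip.map (Over.forget Z)
  have w₁ := (hψ.comp hrκ).eq hK' (hακ ▸ he.comp hψ')
  have w₂ := (hπ.comp hrβ).eq hG' (hαβ ▸ he.comp hπ')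
  have w₃ := (hrχ.comp hrμ).eq hM' (hκμ ▸ hrκ.comp hrχ')
  have w₄ := (hφ.comp hrμ).eq hM' (hβμ ▸ hrβ.comp hφ')
  exact hpb.weq_of_cospan hR hR' (hχ hK hM hrχ) (hχ' hK' hM' hrχ') (hκ hK hK' hrκ)
    (hβ hG hG' hrβ) (hμ hM hM' hrμ) (congrArg CommaMorphism.left w₃)
    (congrArg CommaMorphism.left w₄) (congrArg CommaMorphism.left w₁)
    (congrArg CommaMorphism.left w₂)

end PullbacksLogicallyBehaved

end Cogluing

section Precomposition

variable {C : Type u} [Category.{v} C]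

namespace Pushforward

section Transpose

variable {A B X : C} {k : X ⟶ B} {p : B ⟶ A} (P : Pushforward k p)

theorem transpose_comp_hom {T Y : C} (t : T ⟶ A) (y : Y ⟶ T) (u : Y ⟶ X)
    (h : IsPullback y (u ≫ k) t p) : P.transpose t y u h ≫ P.hom = t :=
  (P.existsUnique_transpose t y u h).choose_spec.1.1

theorem evHom_ev_transpose {T Y : C} (t : T ⟶ A) (y : Y ⟶ T) (u : Y ⟶ X)
    (h : IsPullback y (u ≫ k) t p) {V : C} (x : V ⟶ T) (b : V ⟶ B)
    (hxb : (x ≫ P.transpose t y u h) ≫ P.hom = b ≫ p) (l : V ⟶ Y) (hx : l ≫ y = x)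
    (hb : l ≫ u ≫ k = b) : (evHom.{w} P).ev (x ≫ P.transpose t y u h) b hxb = l ≫ u := by
  obtain ⟨m, hm, hmu⟩ := (P.existsUnique_transpose t y u h).choose_spec.1.2
  have hm' : m ≫ P.proj = y ≫ P.transpose t y u h := hm
  rw [P.evHom_ev_of_comp _ _ hxb (l ≫ m) (by rw [Category.assoc, hm', reassoc_of% hx])
    (by rw [Category.assoc, reassoc_of% hmu, hb]), Category.assoc, hmu]

variable [HasPullbacks C] {A' B' F D : C} {p' : B' ⟶ A'} {g : B' ⟶ B} {f : A' ⟶ A}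
  (sq : g ≫ p = p' ≫ f) {a : F ⟶ P.obj} {a' : F ⟶ A'} (hF : IsPullback a a' P.hom f) {d : D ⟶ X}
  {k' : D ⟶ B'} (hD : IsPullback d k' k g) (P' : Pushforward k' p')

theorem precomp_comp_hom : P.precomp sq hF hD P' ≫ P'.hom = a' :=
  P'.transpose_comp_hom _ _ _ _

theorem evHom_ev_precomp {V : C} (x : V ⟶ F) (y : V ⟶ B') (hxy : x ≫ a' = y ≫ p') :
    (evHom.{w} P').ev (x ≫ P.precomp sq hF hD P') y
        (by simpa only [Over.mk_hom, Category.assoc, precomp_comp_hom]) ≫ d =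
      (evHom.{w} P).ev (x ≫ a) (y ≫ g)
        (by simp only [Over.mk_hom, Category.assoc, hF.w, sq, reassoc_of% hxy]) := by
  have hG := IsPullback.of_hasPullback a' p'
  have hfst : P.pullbackEv sq hF hD hG ≫ d = P.isPullback.lift _ _ _ ≫ P.ev := hD.lift_fst _ _ _
  have hsnd : P.pullbackEv sq hF hD hG ≫ k' = _ := hD.lift_snd _ _ _
  refine (congrArg (· ≫ d) (P'.evHom_ev_transpose _ _ _ _ x y _ (hG.lift x y hxy)
    (hG.lift_fst _ _ _) ((congrArg _ hsnd).trans (hG.lift_snd _ _ _)))).trans ?_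
  rw [Category.assoc, hfst, ← Category.assoc]
  refine (P.evHom_ev_of_comp _ _ _ _ ?_ ?_).symm
  · rw [Category.assoc, P.isPullback.lift_fst, hG.lift_fst_assoc]
  · rw [Category.assoc, P.isPullback.lift_snd, hG.lift_snd_assoc]

end Transpose

section EvHomPullback

variable {A B X Y Z D E : C} {q : Y ⟶ A} {b : Y ⟶ B} {k : X ⟶ B} {d : D ⟶ X} {k' : D ⟶ Y}
  (P : Pushforward k' q) (hD : IsPullback d k' k b) {a : Z ⟶ A} {e : E ⟶ P.obj} {t : E ⟶ Z}
  (hE : IsPullback e t P.hom a)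

/-- The element of `(Over.map a).op ⋙ pullbackHomPsh q b k` induced by the evaluation map of the
pushforward along `q` of the pullback of `k` along `b`. It is universal, see
`isRepresentedBy_evHomPullback`. -/
noncomputable abbrev evHomPullback :
    PullbackHom.{w} q b k ((Over.map a).obj (Over.mk t)) :=
  (P.evHom.postcomp d b (Category.id_comp b) hD.w).restrict
    (Over.homMk e hE.w : (Over.map a).obj (Over.mk t) ⟶ Over.mk P.hom)

theorem isRepresentedBy_evHomPullback [HasPullbacks C] :
    ((Over.map a).op ⋙ pullbackHomPsh.{w} q b k).IsRepresentedBy (X := Over.mk t)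
      (P.evHomPullback hD hE) :=
  isRepresentedBy_map_of_isPullback (P.isRepresentedBy_postcomp_evHom hD) _ hE

end EvHomPullback

section RepresentsPrecomp

variable [HasPullbacks C] {A B X Y Z A' Y' X₁ D F E E' : C} {q : Y ⟶ A} {b : Y ⟶ B} {k : X ⟶ B}
  {q' : Y' ⟶ A'} {g : Y' ⟶ Y} {f : A' ⟶ A} (sq : g ≫ q = q' ≫ f) {d₁ : X₁ ⟶ X} {k₁ : X₁ ⟶ Y}
  (hX₁ : IsPullback d₁ k₁ k b) (P : Pushforward k₁ q) {c : F ⟶ P.obj} {c' : F ⟶ A'}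
  (hF : IsPullback c c' P.hom f) {d : D ⟶ X₁} {k' : D ⟶ Y'} (hD : IsPullback d k' k₁ g)
  (P' : Pushforward k' q') {a' : Z ⟶ A'} {e : E ⟶ F} {t : E ⟶ Z} (hE : IsPullback e t c' a')
  {e' : E' ⟶ P'.obj} {t' : E' ⟶ Z} (hE' : IsPullback e' t' P'.hom a')

theorem represents_precomp :
    Represents (pullbackHomPsh.precomp k g f sq rfl rfl)
      (P.evHomPullback.{w} hX₁ (hE.paste_horiz hF))
      (P'.evHomPullback (hD.paste_horiz hX₁) hE')
      (Over.homMk (hE'.lift (e ≫ P.precomp sq hF hD P') t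
        (by rw [Category.assoc, precomp_comp_hom, hE.w])) (hE'.lift_snd _ _ _) :
        Over.mk t ⟶ Over.mk t') := by
  refine PullbackHom.ext_ev fun x y (h : x ≫ t ≫ a' = y ≫ q') => ?_
  have hxe : (x ≫ e) ≫ c' = y ≫ q' := by rw [Category.assoc, hE.w, h]
  refine Eq.trans ?_ ((congrArg (· ≫ d₁) (P.evHom_ev_precomp.{w} sq hF hD P' _ y hxe)).trans ?_)
  · refine (Category.assoc _ _ _).symm.trans (congrArg (· ≫ d₁) (congrArg (· ≫ d) ?_))
    exact PullbackHom.ev_congr _ (by simp) rfl _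
  · exact congrArg (· ≫ d₁) (PullbackHom.ev_congr _ (by simp) rfl _)

end RepresentsPrecomp

end Pushforward

end Precomposition

section PullbackHomFibrations

variable {C : Type u} [Category.{v} C] [HasPullbacks C] {Fib W : MorphismProperty C}
  [Fib.IsStableUnderBaseChange] (hFib : FibrationsStableUnderPushforward Fib) {A B X Y Z : C}
  {q : Y ⟶ A} {k : X ⟶ B}

include hFib

theorem isRepresentable_pullbackHomPsh (a : Z ⟶ A) (b : Y ⟶ B) (hq : Fib q) (hk : Fib k) :
    ((Over.map a).op ⋙ pullbackHomPsh.{w} q b k).IsRepresentable := by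
  have hD := IsPullback.of_hasPullback k b
  obtain ⟨P⟩ := hFib.nonempty_pushforward _ q (Fib.of_isPullback hD hk) hq
  have hev := P.isRepresentedBy_evHomPullback hD (.of_hasPullback P.hom a)
  exact hev.representableBy.isRepresentable

theorem representedIn_postcomp {N : C} {n : N ⟶ B} {m : X ⟶ N} (hm : m ≫ n = k) (a : Z ⟶ A)
    (b : Y ⟶ B) (hq : Fib q) (hfm : Fib m) (hn : Fib n) :
    RepresentedIn Fib.over (Functor.whiskerLeft (Over.map a).op (pullbackHomPsh.postcomp.{w} q m
      (𝟙 B) (Category.comp_id b) (by rw [hm, Category.comp_id]))) := by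
  have := isRepresentable_pullbackHomPsh.{w} hFib a b hq hn
  have hG := Functor.IsRepresentedBy.of_isRepresentable
    (F := (Over.map a).op ⋙ pullbackHomPsh.{w} q b n)
  obtain ⟨E, y, e, hy, he, hfe⟩ := exists_isRepresentedBy_of_isPullback hm
    (IsPullback.of_vert_isIso ⟨(Category.comp_id _).trans (Category.id_comp _).symm⟩) hG hFib hfm hq
  exact he.representedIn hy hG hfe

theorem PushforwardsLogicallyBehaved.representedIn_precomp [W.RespectsIso]
    (hpf : PushforwardsLogicallyBehaved Fib W) {A' Y' : C} {q' : Y' ⟶ A'} {a : Z ⟶ A} {a' : Z ⟶ A'}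
    {b : Y ⟶ B} {b' : Y' ⟶ B} {g : Y' ⟶ Y} {f : A' ⟶ A} (sq : g ≫ q = q' ≫ f) (ha : a' ≫ f = a)
    (hb : g ≫ b = b') (hpb : PullbacksLogicallyBehaved Fib W) (hk : Fib k) (hq : Fib q)
    (hq' : Fib q') (hf : W f) (hg : W g) :
    RepresentedIn W.over (pullbackHomPsh.precomp.{w} k g f sq ha hb) := by
  subst ha hb
  have hX₁ := IsPullback.of_hasPullback k b
  have hk₁ := Fib.of_isPullback hX₁ hk
  have hD := IsPullback.of_hasPullback (pullback.snd k b) g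
  have hk' := Fib.of_isPullback hD hk₁
  obtain ⟨P⟩ := hFib.nonempty_pushforward _ q hk₁ hq
  obtain ⟨P'⟩ := hFib.nonempty_pushforward _ q' hk' hq'
  have hF := IsPullback.of_hasPullback P.hom f
  have hE := IsPullback.of_hasPullback (pullback.snd P.hom f) a'
  have hE' := IsPullback.of_hasPullback P'.hom a'
  exact (P.represents_precomp sq hX₁ hF hD P' hE hE').representedIn
    (P.isRepresentedBy_evHomPullback _ _) (P'.isRepresentedBy_evHomPullback _ _)
    (hpb.weq_pullback hE hE' _ (P.precomp_comp_hom sq hF hD P')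
      (Fib.of_isPullback hF (hFib.fib_hom P hk₁ hq)) (hFib.fib_hom P' hk' hq')
      (hpf.weq_precomp P sq hF hD P' hk₁ hq hq' hf hg))

end PullbackHomFibrations

section ShapeHom

variable {I : Type u₁} [Category.{v₁} I] {C : Type u₂} [Category.{v₂} C] {B X : I ⥤ C} {i : I}
  {Z : C}

/-- A map of shapes with the same vertex, along which natural families can be precomposed: maps
`base` and `tot` of diagrams, compatible with the maps `a`, `q` and `b`. Naturality of `base` is not
needed for the precomposition. -/
structure Shape.Hom (D' D : Shape B i Z) where
  base : ∀ f, D'.base.obj f ⟶ D.base.obj f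
  tot : ∀ f, D'.tot.obj f ⟶ D.tot.obj f
  tot_q : ∀ f, tot f ≫ D.q f = D'.q f ≫ base f
  a_base : ∀ f, D'.a f ≫ base f = D.a f
  tot_b : ∀ f, tot f ≫ D.b f = D'.b f
  tot_map : ∀ {f g : Under i} (u : f ⟶ g), tot f ≫ D.tot.map u = D'.tot.map u ≫ tot g

variable {D' D : Shape B i Z} (θ : D'.Hom D)

/-- Precomposition of maps `T ×_{base f} tot f ⟶ Y` over `B_j` with a map of shapes. -/
abbrev Shape.Hom.precomp (f : Under i) {Y : C} (n : Y ⟶ B.obj f.right) :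
    (Over.map (D.a f)).op ⋙ pullbackHomPsh.{w} (D.q f) (D.b f) n ⟶
      (Over.map (D'.a f)).op ⋙ pullbackHomPsh.{w} (D'.q f) (D'.b f) n :=
  pullbackHomPsh.precomp n (θ.tot f) (θ.base f) (θ.tot_q f) (θ.a_base f) (θ.tot_b f)

namespace secPsh

/-- Precomposition of natural families with a map of shapes. -/
abbrev precomp (k : X ⟶ B) (S : Set (Under i)) : secPsh D k S ⟶ secPsh D' k S where
  app T := ↾fun s =>
    { val := fun f hf => (s.val f hf).precomp (θ.tot f) (θ.base f) (θ.tot_q f) (θ.a_base f)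
        (θ.tot_b f)
      natural := fun hf hf' u V x y h => by
        refine (s.natural hf hf' u _ _ _).trans (PullbackHom.ev_congr _ rfl ?_ _)
        rw [Category.assoc, Category.assoc, θ.tot_map] }

variable {k : X ⟶ B} {S : Set (Under i)} [HasFiniteLimits C] [∀ i : I, Finite (Under i)]

theorem matching_precomp {f : Under i} (hf : ∀ h : Boundary f.right, extend f h ∈ S) :
    matching D k hf ≫ θ.precomp f (relMatchingFst k f.right) =
      precomp θ k S ≫ matching D' k hf := by
  ext T s
  refine PullbackHom.ext_relMatchingπ fun x y hxy h => ?_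
  refine (Sec.matching_ev_π hf s x (y ≫ θ.tot f) _ h).trans (Eq.trans ?_
    (Sec.matching_ev_π hf ((precomp θ k S).app T s) x y hxy h).symm)
  exact PullbackHom.ev_congr _ rfl (by rw [Category.assoc, Category.assoc, θ.tot_map]) _

variable [IsInverse I] {Fib W : MorphismProperty C} [Fib.IsMultiplicative]
  [Fib.IsStableUnderBaseChange] [W.HasTwoOutOfThreeProperty] [W.RespectsIso] [W.ContainsIdentities]

theorem representedIn_precomp (hFib : FibrationsStableUnderPushforward Fib)
    (hpb : PullbacksLogicallyBehaved Fib W) (hpf : PushforwardsLogicallyBehaved Fib W)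
    (hk : IsReedyFibration Fib k) (hq : ∀ f, Fib (D.q f)) (hq' : ∀ f, Fib (D'.q f))
    (hbase : ∀ f, W (θ.base f)) (htot : ∀ f, W (θ.tot f)) (hS : IsCosieve S) :
    RepresentedIn W.over (precomp θ k S) := by
  refine cosieve_induction (P := fun S => RepresentedIn W.over (precomp θ k S)) ?_
    (fun f S hfS hS hf ih => ?_) hS
  · obtain ⟨s, hs⟩ := exists_isRepresentedBy_empty D k
    obtain ⟨s', hs'⟩ := exists_isRepresentedBy_empty D' k
    refine Represents.representedIn (e := 𝟙 _) ?_ hs hs' (W.id_mem Z)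
    exact Sec.ext_ev fun f hf => hf.elim
  · have hkf := hk.fib_app hFib f.right
    have hmf := hk.fib_relMatchingFst hFib f.right
    have hrep (D : Shape B i Z) (hq : ∀ f, Fib (D.q f)) : (secPsh D k S).IsRepresentable := by
      obtain ⟨E, s, hs, -⟩ := exists_isRepresentedBy D k hFib hk hq hS
      exact hs.representableBy.isRepresentable
    have := hrep D hq
    have := hrep D' hq'
    have := isRepresentable_pullbackHomPsh.{max u₁ v₁} hFib (D.a f) (D.b f) (hq f) hkf
    have := isRepresentable_pullbackHomPsh.{max u₁ v₁} hFib (D'.a f) (D'.b f) (hq' f) hkf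
    have := isRepresentable_pullbackHomPsh.{max u₁ v₁} hFib (D.a f) (D.b f) (hq f) hmf
    have := isRepresentable_pullbackHomPsh.{max u₁ v₁} hFib (D'.a f) (D'.b f) (hq' f) hmf
    exact hpb.representedIn_of_isPullback (isPullback_insert D k hfS hS hf)
      (isPullback_insert D' k hfS hS hf)
      (representedIn_postcomp hFib relMatchingMap_fst _ _ (hq f) (hk f.right) hmf)
      (representedIn_postcomp hFib relMatchingMap_fst _ _ (hq' f) (hk f.right) hmf) ih
      (hpf.representedIn_precomp hFib (θ.tot_q f) (θ.a_base f) (θ.tot_b f) hpb hkf (hq f) (hq' f)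
        (hbase f) (htot f))
      (hpf.representedIn_precomp hFib (θ.tot_q f) (θ.a_base f) (θ.tot_b f) hpb hmf (hq f) (hq' f)
        (hbase f) (htot f)) rfl rfl (matching_precomp θ hf) rfl

end secPsh

end ShapeHom

section ConstantShape

variable {I : Type u₁} [Category.{v₁} I] {C : Type u₂} [Category.{v₂} C] {A B X : I ⥤ C}

/-- The shape `B_i ⟶ A_i` for all `f : i ⟶ j`. A natural family over all of `i/I` is determined by
its component at the identity, see `secPsh.constSec_bijective`. -/
abbrev Shape.const (p : B ⟶ A) (i : I) : Shape B i (A.obj i) where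
  base := (Functor.const _).obj (A.obj i)
  tot := (Functor.const _).obj (B.obj i)
  a _ := 𝟙 _
  a_map _ := Category.id_comp _
  q _ := p.app i
  q_map _ := (Category.id_comp _).trans (Category.comp_id _).symm
  b f := B.map f.hom
  b_map u := by
    rw [← B.map_comp, Under.w]
    exact Category.id_comp _

/-- The map of shapes given by `A_f` and `B_f` for `f : i ⟶ j`. -/
abbrev Shape.fromConst (p : B ⟶ A) (i : I) : (Shape.const p i).Hom (Shape.ofHom p i) where
  base f := A.map f.hom
  tot f := B.map f.hom
  tot_q f := p.naturality f.hom
  a_base _ := Category.id_comp _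
  tot_b _ := Category.comp_id _
  tot_map u := by
    rw [← B.map_comp, Under.w]
    exact (Category.id_comp _).symm

variable {p : B ⟶ A} {k : X ⟶ B} {i : I}

/-- The natural family of the composites `T ×_{A_i} B_i ⟶ X_i ⟶ X_j` for `f : i ⟶ j`. -/
@[simps]
def PullbackHom.constSec {T : Over (A.obj i)}
    (u : PullbackHom.{max u₁ v₁} (p.app i) (𝟙 (B.obj i)) (k.app i) T) :
    Sec (Shape.const p i) k Set.univ T where
  val f _ :=
    { ev x y h := u.ev x y (by simpa using h) ≫ X.map f.hom
      ev_comp x y h := by simp [reassoc_of% u.ev_comp]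
      comp_ev z x y h := by rw [← Category.assoc, u.comp_ev] }
  natural {f g} _ _ v _ x y h := by
    rw [Category.assoc, ← X.map_comp, Under.w]
    exact congrArg (· ≫ X.map g.hom) (u.ev_congr rfl (Category.comp_id y).symm _)

namespace secPsh

/-- `PullbackHom.constSec` as a map of presheaves. -/
abbrev constSec (p : B ⟶ A) (k : X ⟶ B) (i : I) :
    pullbackHomPsh.{max u₁ v₁} (p.app i) (𝟙 (B.obj i)) (k.app i) ⟶
      secPsh (Shape.const p i) k Set.univ where
  app T := ↾fun u => PullbackHom.constSec u

theorem constSec_bijective (T : (Over (A.obj i))ᵒᵖ) :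
    Function.Bijective ((constSec p k i).app T) := by
  have hid {V : C} (x : V ⟶ T.unop.left) {y : V ⟶ B.obj i}
      (h : x ≫ T.unop.hom = y ≫ p.app i) : x ≫ T.unop.hom ≫ 𝟙 _ = y ≫ p.app i := by
    rw [Category.comp_id, h]
  refine ⟨fun u u' huu' => PullbackHom.ext_ev fun x y h => ?_, fun s => ?_⟩
  · have : u.ev x y h ≫ X.map (𝟙 i) = u'.ev x y h ≫ X.map (𝟙 i) :=
      congrArg (fun s : Sec (Shape.const p i) k Set.univ T.unop =>
        (s.val (Under.mk (𝟙 i)) trivial).ev x y (hid x h)) huu'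
    simpa using this
  · let s₀ := Sec.val s (Under.mk (𝟙 i)) trivial
    refine ⟨{ ev := fun x y h => s₀.ev x y (hid x h)
              ev_comp := fun x y h => (s₀.ev_comp x y _).trans (by simp)
              comp_ev := fun z x y h => s₀.comp_ev z x y _ }, Sec.ext_ev fun f hf V x y h => ?_⟩
    refine (Sec.natural s (f := Under.mk (𝟙 i)) trivial hf (Under.homMk f.hom) x y h).trans ?_
    exact PullbackHom.ev_congr _ rfl (Category.comp_id y) _

end secPsh

theorem Pushforward.isRepresentedBy_constSec_evHom [HasPullbacks C]
    (Pi : Pushforward (k.app i) (p.app i)) :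
    (secPsh (Shape.const p i) k Set.univ).IsRepresentedBy (X := Over.mk Pi.hom)
      (PullbackHom.constSec Pi.evHom) := by
  have : IsIso (secPsh.constSec p k i) := by
    rw [NatTrans.isIso_iff_isIso_app]
    exact fun T => (isIso_iff_bijective _).2 (secPsh.constSec_bijective T)
  exact Pi.isRepresentedBy_evHom.of_natIso (asIso (secPsh.constSec p k i))

end ConstantShape

section PushforwardExt

variable {C : Type u} [Category.{v} C] [HasPullbacks C] {A B X : C} {k : X ⟶ B} {p : B ⟶ A}

namespace Pushforward

theorem hom_ext (P : Pushforward k p) {T : C} {t t' : T ⟶ P.obj} (hom : t ≫ P.hom = t' ≫ P.hom)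
    (ev : ∀ {V : C} (x : V ⟶ T) (y : V ⟶ B) (h : (x ≫ t) ≫ P.hom = y ≫ p)
      (h' : (x ≫ t') ≫ P.hom = y ≫ p),
      (evHom.{w} P).ev (x ≫ t) y h = (evHom.{w} P).ev (x ≫ t') y h') : t = t' := by
  let v : Over.mk (t ≫ P.hom) ⟶ Over.mk P.hom := Over.homMk t
  let v' : Over.mk (t ≫ P.hom) ⟶ Over.mk P.hom := Over.homMk t' hom.symm
  have hvv' : (evHom.{w} P).restrict v = (evHom.{w} P).restrict v' :=
    PullbackHom.ext_ev fun x y (h : x ≫ t ≫ P.hom = y ≫ p) => by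
      exact ev x y (by rw [Category.assoc, h]) (by rw [Category.assoc, ← hom, h])
  exact congrArg (fun r => r.left) (P.isRepresentedBy_evHom.map_bijective.1 hvv')

variable {X' : C} {k' : X' ⟶ B} (P : Pushforward k p) (P' : Pushforward k' p) {m : X ⟶ X'}
  (hm : m ≫ k' = k)

omit [HasPullbacks C] in
theorem map_comp_hom : P.map P' m hm ≫ P'.hom = P.hom :=
  P'.transpose_comp_hom _ _ _ _

omit [HasPullbacks C] in
theorem evHom_ev_map {V : C} (x : V ⟶ P.obj) (y : V ⟶ B) (h : x ≫ P.hom = y ≫ p) :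
    (evHom.{w} P').ev (x ≫ P.map P' m hm) y (by
      simpa only [Over.mk_hom, Category.assoc, map_comp_hom]) = (evHom.{w} P).ev x y h ≫ m := by
  refine (P'.evHom_ev_transpose _ _ _ _ x y _ (P.isPullback.lift x y h)
    (P.isPullback.lift_fst _ _ _) ?_).trans (Category.assoc _ _ _).symm
  rw [Category.assoc, hm, P.isPullback.lift_snd]

end Pushforward

end PushforwardExt

section Comparison

variable {I : Type u₁} [Category.{v₁} I] {C : Type u₂} [Category.{v₂} C]

namespace Pushforward

section HasPullbacks

variable [HasPullbacks C] {A B X : I ⥤ C} {k : X ⟶ B} {p : B ⟶ A} (P : Pushforward k p) {i j : I}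
  (Pi : Pushforward (k.app i) (p.app i)) (Pj : Pushforward (k.app j) (p.app j))

theorem comparison_comp_hom : P.comparison j Pj ≫ Pj.hom = P.hom.app j :=
  Pj.transpose_comp_hom _ _ _ _

theorem evHom_ev_comparison {V : C} (x : V ⟶ P.obj.obj j) (y : V ⟶ B.obj j)
    (h : x ≫ P.hom.app j = y ≫ p.app j) :
    (evHom.{w} Pj).ev (x ≫ P.comparison j Pj) y (by
      simpa only [Over.mk_hom, Category.assoc, comparison_comp_hom]) =
      ((evHom.{w} P).app j).ev x y h := by
  have hP := P.isPullback.map ((evaluation I C).obj j)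
  refine (Pj.evHom_ev_transpose _ _ _ _ x y _ (hP.lift x y h) (hP.lift_fst _ _ _)
    (hP.lift_snd _ _ _)).trans ?_
  refine Eq.symm (Eq.trans ?_ (congrArg (_ ≫ ·)
    (NatTrans.congr_app (PullbackHom.ofHom_ev_fst_snd.{w} (T := Over.mk P.hom) P.isPullback P.ev
      (Category.comp_id _).symm) j)))
  refine (PullbackHom.ev_eq_lift_comp (T := Over.mk (P.hom.app j)) hP _ x y h).trans
    (congrArg (_ ≫ ·) ?_)
  exact (evHom.{w} P).app_ev _ _ P.isPullback.w j

theorem represents_comparison :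
    Represents (secPsh.precomp (Shape.fromConst p i) k Set.univ) (P.evHom.sec i)
      (PullbackHom.constSec Pi.evHom)
      (Over.homMk (P.comparison i Pi) (P.comparison_comp_hom Pi) :
        Over.mk (P.hom.app i) ⟶ Over.mk Pi.hom) := by
  refine Sec.ext_ev fun f _ V x y h => ?_
  have hxy : x ≫ P.hom.app i = y ≫ p.app i := by simpa using h
  calc (evHom.{max u₁ v₁} Pi).ev (x ≫ P.comparison i Pi) y _ ≫ X.map f.hom
    _ = ((evHom.{max u₁ v₁} P).app i).ev x y hxy ≫ X.map f.hom :=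
      congrArg (· ≫ X.map f.hom) (P.evHom_ev_comparison Pi x y hxy)
    _ = _ := (evHom.{max u₁ v₁} P).app_ev_map f.hom x y hxy

theorem comparison_naturality (f : i ⟶ j) {F D : C} {c : F ⟶ Pj.obj} {c' : F ⟶ A.obj i}
    (hF : IsPullback c c' Pj.hom (A.map f)) {d : D ⟶ X.obj j} {k' : D ⟶ B.obj i}
    (hD : IsPullback d k' (k.app j) (B.map f)) (P' : Pushforward k' (p.app i))
    {a : P.obj.obj i ⟶ F} (hac : a ≫ c = P.obj.map f ≫ P.comparison j Pj)
    (hac' : a ≫ c' = P.hom.app i) {m : X.obj i ⟶ D} (hmd : m ≫ d = X.map f)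
    (hmk : m ≫ k' = k.app i) :
    a ≫ Pj.precomp (p.naturality f) hF hD P' = P.comparison i Pi ≫ Pi.map P' m hmk := by
  have hhom : (a ≫ Pj.precomp (p.naturality f) hF hD P') ≫ P'.hom = P.hom.app i := by
    rw [Category.assoc, precomp_comp_hom, hac']
  have hhom' : (P.comparison i Pi ≫ Pi.map P' m hmk) ≫ P'.hom = P.hom.app i := by
    rw [Category.assoc, map_comp_hom, comparison_comp_hom]
  refine P'.hom_ext.{0} (hhom.trans hhom'.symm) fun x y h _ => hD.hom_ext ?_ ?_
  · have hxy : x ≫ P.hom.app i = y ≫ p.app i := by rw [← h, Category.assoc, hhom]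
    have hxay : (x ≫ a) ≫ c' = y ≫ p.app i := by rw [Category.assoc, hac', hxy]
    have hxκy : (x ≫ P.comparison i Pi) ≫ Pi.hom = y ≫ p.app i := by
      rw [Category.assoc, comparison_comp_hom, hxy]
    have hxfy : (x ≫ P.obj.map f) ≫ P.hom.app j = (y ≫ B.map f) ≫ p.app j := by
      simp [reassoc_of% hxy]
    calc (evHom.{0} P').ev (x ≫ a ≫ Pj.precomp (p.naturality f) hF hD P') y h ≫ d
      _ = (evHom.{0} P').ev ((x ≫ a) ≫ Pj.precomp (p.naturality f) hF hD P') y _ ≫ d :=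
        congrArg (· ≫ d) ((evHom.{0} P').ev_congr (Category.assoc _ _ _).symm rfl _)
      _ = (evHom.{0} Pj).ev ((x ≫ a) ≫ c) (y ≫ B.map f) _ := Pj.evHom_ev_precomp _ hF hD P' _ y hxay
      _ = (evHom.{0} Pj).ev ((x ≫ P.obj.map f) ≫ P.comparison j Pj) (y ≫ B.map f) _ :=
        (evHom.{0} Pj).ev_congr (by rw [Category.assoc, hac, Category.assoc]) rfl _
      _ = ((evHom.{0} P).app j).ev (x ≫ P.obj.map f) (y ≫ B.map f) _ :=
        P.evHom_ev_comparison Pj _ _ hxfy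
      _ = ((evHom.{0} P).app i).ev x y hxy ≫ X.map f := ((evHom.{0} P).app_ev_map f x y hxy).symm
      _ = ((evHom.{0} Pi).ev (x ≫ P.comparison i Pi) y hxκy ≫ m) ≫ d := by
        rw [P.evHom_ev_comparison Pi x y hxy, Category.assoc, hmd]
      _ = (evHom.{0} P').ev ((x ≫ P.comparison i Pi) ≫ Pi.map P' m hmk) y _ ≫ d :=
        congrArg (· ≫ d) (Pi.evHom_ev_map P' hmk _ y hxκy).symm
      _ = _ := congrArg (· ≫ d) ((evHom.{0} P').ev_congr (Category.assoc _ _ _) rfl _)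
  · rw [PullbackHom.ev_comp, PullbackHom.ev_comp]

end HasPullbacks

variable [HasFiniteLimits C] {A B X : I ⥤ C} {k : X ⟶ B} {p : B ⟶ A} {Fib W : MorphismProperty C}
  [Fib.IsStableUnderBaseChange] [W.HasTwoOutOfThreeProperty]
  (hFib : FibrationsStableUnderPushforward Fib) (hpb : PullbacksLogicallyBehaved Fib W)
  (hpf : PushforwardsLogicallyBehaved Fib W) (P : Pushforward k p) {i : I}
  (Pi : Pushforward (k.app i) (p.app i))

include hFib hpb hpf

/- The map `a : (p_* X)_i ⟶ A_i ×_{A_j} (p_j)_* X_j` with first component `P_f ≫ κ_j` is a weak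
equivalence, because its composite with the comparison map for the square `p_f` factors through
`κ_i`. -/
theorem weq_map_of_weq_comparison {j : I} (f : i ⟶ j) (hX : W (X.map f)) (hB : W (B.map f))
    (hA : W (A.map f)) (hp : ∀ j, Fib (p.app j)) (hk : ∀ j, Fib (k.app j))
    (Pj : Pushforward (k.app j) (p.app j)) (hi : W (P.comparison i Pi))
    (hj : W (P.comparison j Pj)) : W (P.obj.map f) := by
  have hF := IsPullback.of_hasPullback Pj.hom (A.map f)
  have hD := IsPullback.of_hasPullback (k.app j) (B.map f)
  have hk' := Fib.of_isPullback hD (hk j)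
  obtain ⟨P'⟩ := hFib.nonempty_pushforward _ (p.app i) hk' (hp i)
  let m := hD.lift (X.map f) (k.app i) (k.naturality f)
  have hmd : m ≫ pullback.fst _ _ = X.map f := hD.lift_fst _ _ _
  have hmk : m ≫ pullback.snd _ _ = k.app i := hD.lift_snd _ _ _
  have hm : W m := W.of_postcomp _ _ (hpb.weq_of_isPullback hD (hk j) hB) (by rwa [hmd])
  let a := hF.lift (P.obj.map f ≫ P.comparison j Pj) (P.hom.app i) (by
    rw [Category.assoc, comparison_comp_hom, NatTrans.naturality])
  have hac : a ≫ pullback.fst _ _ = P.obj.map f ≫ P.comparison j Pj := hF.lift_fst _ _ _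
  have hac' : a ≫ pullback.snd _ _ = P.hom.app i := hF.lift_snd _ _ _
  have ha : W a := by
    refine W.of_postcomp _ _ (hpf.weq_precomp Pj (p.naturality f) hF hD P' (hk j) (hp j) (hp i)
      hA hB) ?_
    rw [P.comparison_naturality Pi Pj f hF hD P' hac hac' hmd hmk]
    exact W.comp_mem _ _ hi (hpf.weq_map Pi P' m hmk (hp i) (hk i) hk' hm)
  refine W.of_postcomp _ _ hj ?_
  rw [← hac]
  exact W.comp_mem _ _ ha (hpb.weq_of_isPullback hF (hFib.fib_hom Pj (hk j) (hp j)) hA)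

theorem weq_comparison [∀ i : I, Finite (Under i)] [IsInverse I] [Fib.IsMultiplicative]
    [W.RespectsIso] [W.ContainsIdentities] (hB : ∀ {j : I} (f : i ⟶ j), W (B.map f))
    (hA : ∀ {j : I} (f : i ⟶ j), W (A.map f)) (hp : ∀ j, Fib (p.app j))
    (hk : IsReedyFibration Fib k) : W (P.comparison i Pi) :=
  secPsh.representedIn_precomp (Shape.fromConst p i) hFib hpb hpf hk (fun f => hp f.right)
    (fun _ => hp i) (fun f => hA f.hom) (fun f => hB f.hom) (isCosieve_univ i)
    (P.isRepresentedBy_sec_evHom hFib hk hp i) Pi.isRepresentedBy_constSec_evHom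
    (P.represents_comparison Pi)

end Pushforward

end Comparison

end InverseDiagrams

theorem mainTheorem3_general
    {I : Type u₁} [Category.{v₁} I] [InverseDiagrams.IsInverse I] [∀ i : I, Finite (Under i)]
    {C : Type u₂} [Category.{v₂} C] [HasFiniteLimits C]
    {Fib W : MorphismProperty C} [Fib.IsMultiplicative] [Fib.IsStableUnderBaseChange]
    [W.HasTwoOutOfThreeProperty] [W.RespectsIso] [W.ContainsIdentities]
    (hFib : InverseDiagrams.FibrationsStableUnderPushforward Fib)
    (hpb : InverseDiagrams.PullbacksLogicallyBehaved Fib W)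
    (hpf : InverseDiagrams.PushforwardsLogicallyBehaved Fib W)
    {i : I} {X B A : I ⥤ C} (hX : ∀ (j : I) (f : i ⟶ j), W (X.map f))
    (hB : ∀ (j : I) (f : i ⟶ j), W (B.map f)) (hA : ∀ (j : I) (f : i ⟶ j), W (A.map f))
    {p : B ⟶ A} (hp : ∀ j, Fib (p.app j))
    {k : X ⟶ B} (hk : InverseDiagrams.IsReedyFibration Fib k) :
    Nonempty (InverseDiagrams.Pushforward k p) ∧
    ∀ P : InverseDiagrams.Pushforward k p,
      InverseDiagrams.IsReedyFibration Fib P.hom ∧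
      (∀ (j : I) (f : i ⟶ j), W (P.obj.map f)) ∧
      (∀ (j : I) (_ : i ⟶ j),
        Nonempty (InverseDiagrams.Pushforward (k.app j) (p.app j)) ∧
        ∀ Pj : InverseDiagrams.Pushforward (k.app j) (p.app j), W (P.comparison j Pj)) := by
  have hk' := hk.fib_app hFib
  refine ⟨InverseDiagrams.nonempty_pushforward_of_reedy hFib hk hp, fun P => ?_⟩
  have weq_map {F : I ⥤ C} (hF : ∀ (j : I) (f : i ⟶ j), W (F.map f)) {j l : I} (f : i ⟶ j)
      (g : j ⟶ l) : W (F.map g) :=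
    W.of_precomp _ _ (hF j f) (F.map_comp f g ▸ hF l (f ≫ g))
  have hκ : ∀ (j : I) (_ : i ⟶ j) (Pj : InverseDiagrams.Pushforward (k.app j) (p.app j)),
      W (P.comparison j Pj) := fun j f Pj =>
    P.weq_comparison hFib hpb hpf Pj (weq_map hB f) (weq_map hA f) hp hk
  have hne := fun j => hFib.nonempty_pushforward (k.app j) (p.app j) (hk' j) (hp j)
  refine ⟨P.isReedyFibration_hom hFib hk hp, fun j f => ?_, fun j f => ⟨hne j, hκ j f⟩⟩
  obtain ⟨Pi⟩ := hne i
  obtain ⟨Pj⟩ := hne j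
  exact P.weq_map_of_weq_comparison hFib hpb hpf Pi f (hX j f) (hB j f) (hA j f) hp hk' Pj
    (hκ i (𝟙 i) Pi) (hκ j f Pj)

theorem mainTheorem3
    {I : Type u₁} [Category.{v₁} I] [InverseDiagrams.IsInverse I] [∀ i : I, Finite (Under i)]
    {C : Type u₂} [Category.{v₂} C] [HasFiniteLimits C]
    -- weak equivalences in `I`
    (WI : MorphismProperty I) [WI.IsMultiplicative] [WI.HasTwoOutOfThreeProperty]
    (hWI : MorphismProperty.isomorphisms I ≤ WI)
    -- weak equivalences in `C`
    (W : MorphismProperty C) [W.IsMultiplicative] [W.HasTwoOutOfThreeProperty]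
    (hW : MorphismProperty.isomorphisms C ≤ W)
    -- fibrations in `C`
    (Fib : MorphismProperty C) [Fib.IsMultiplicative] [Fib.IsStableUnderBaseChange]
    (hFib : InverseDiagrams.FibrationsStableUnderPushforward Fib)
    (hpb : InverseDiagrams.PullbacksLogicallyBehaved Fib W)
    (hpf : InverseDiagrams.PushforwardsLogicallyBehaved Fib W)
    -- all maps out of `i` are weak equivalences
    (i : I) (hi : ∀ (j : I) (f : i ⟶ j), WI f)
    {X B A : I ⥤ C}
    (hX : InverseDiagrams.IsHomotopical WI W X)
    (hB : InverseDiagrams.IsHomotopical WI W B)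
    (hA : InverseDiagrams.IsHomotopical WI W A)
    (p : B ⟶ A) (hp : InverseDiagrams.IsReedyFibration Fib p)
    (k : X ⟶ B) (hk : InverseDiagrams.IsReedyFibration Fib k) :
    -- the pushforward `p_* X` exists, and whichever choice `P` of it is taken:
    Nonempty (InverseDiagrams.Pushforward k p) ∧
    ∀ P : InverseDiagrams.Pushforward k p,
      InverseDiagrams.IsReedyFibration Fib P.hom ∧
      -- all maps out of `i` are sent to weak equivalences
      (∀ (j : I) (f : i ⟶ j), W (P.obj.map f)) ∧
      -- the comparison map at each `j` under `i` is a weak equivalence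
      (∀ (j : I) (_ : i ⟶ j),
        Nonempty (InverseDiagrams.Pushforward (k.app j) (p.app j)) ∧
        ∀ Pj : InverseDiagrams.Pushforward (k.app j) (p.app j), W (P.comparison j Pj)) := by
  have : W.RespectsIso := MorphismProperty.respectsIso_of_isStableUnderComposition hW
  exact mainTheorem3_general hFib hpb hpf (fun j f => hX f (hi j f)) (fun j f => hB f (hi j f))
    (fun j f => hA f (hi j f)) (hp.fib_app hFib) hk
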